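/- For $n\ge 1$ call $A\in \mathrm{GL}(n)=\mathrm{GL}(n,\mathbb C)$ a pseudo-reflection if it has finite order and its space of fixed points in $\mathbb C^n$ is a hyperplane; call a representation $G\to \mathrm{GL}(n)$ small if its image contains no pseudo-reflection. Two representations are regarded as the same up to conjugacy in $\mathrm{GL}(n)$ if their images are conjugate subgroups of $\mathrm{GL}(n)$. Let $D_{2n}$ be the dihedral group with $2n$ elements, $Q_8$ the quaternion group, and $\mathrm{BD}_3=\langle a,x;\ a^6=1,\ x^2=a^3,\ x^{-1}ax=a^{-1}\rangle$. Let $\zeta_3,\zeta_5\in\mathbb C$ be a primitive third and a primitive fifth root of unity. Up to conjugacy in $\mathrm{GL}(3)$, the faithful small $3$-dimensional representations of the non-abelian groups of order at most $12$ are exactly the following ten, given by generators of their images; no two of the ten are conjugate. 1. $S_3$: $\begin{pmatrix}0&-1&0\\1&-1&0\\0&0&1\end{pmatrix},\ \begin{pmatrix}-1&1&0\\0&1&0\\0&0&-1\end{pmatrix}$ 2. $D_8$: $\begin{pmatrix}0&-1&0\\1&0&0\\0&0&1\end{pmatrix},\ \begin{pmatrix}1&0&0\\0&-1&0\\0&0&-1\end{pmatrix}$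 3. $Q_8$: $\begin{pmatrix}i&0&0\\0&-i&0\\0&0&1\end{pmatrix},\ \begin{pmatrix}0&-1&0\\1&0&0\\0&0&1\end{pmatrix}$ 4. $Q_8$: $\begin{pmatrix}i&0&0\\0&-i&0\\0&0&-1\end{pmatrix},\ \begin{pmatrix}0&-1&0\\1&0&0\\0&0&1\end{pmatrix}$ 5. $D_{10}$: $\begin{pmatrix}\zeta_5&0&0\\0&\zeta_5^4&0\\0&0&1\end{pmatrix},\ \begin{pmatrix}0&1&0\\1&0&0\\0&0&-1\end{pmatrix}$ 6. $D_{12}$: $\begin{pmatrix}-\zeta_3^2&0&0\\0&-\zeta_3&0\\0&0&1\end{pmatrix},\ \begin{pmatrix}0&1&0\\1&0&0\\0&0&-1\end{pmatrix}$ 7. $A_4$: $\begin{pmatrix}0&0&1\\1&0&0\\0&1&0\end{pmatrix},\ \begin{pmatrix}-1&0&0\\0&-1&0\\0&0&1\end{pmatrix}$ 8. $\mathrm{BD}_3$: $\begin{pmatrix}-\zeta_3^2&0&0\\0&-\zeta_3&0\\0&0&1\end{pmatrix},\ \begin{pmatrix}0&-i&0\\-i&0&0\\0&0&1\end{pmatrix}$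 9. $\mathrm{BD}_3$: $\begin{pmatrix}-\zeta_3^2&0&0\\0&-\zeta_3&0\\0&0&-1\end{pmatrix},\ \begin{pmatrix}0&-i&0\\-i&0&0\\0&0&i\end{pmatrix}$ 10. $\mathrm{BD}_3$: $\begin{pmatrix}-\zeta_3^2&0&0\\0&-\zeta_3&0\\0&0&1\end{pmatrix},\ \begin{pmatrix}0&-i&0\\-i&0&0\\0&0&-1\end{pmatrix}$ That is: each of these ten matrix groups is small and isomorphic to the named group, which is non-abelian of order at most $12$; and for every faithful small representation $\rho:G\to\mathrm{GL}(3)$ of a non-abelian group $G$ of order at most $12$ there is exactly one entry whose matrix group is conjugate to $\rho(G)$ in $\mathrm{GL}(3)$, and $G$ is isomorphic to the group named in that entry. All ten representations are reducible except the one of $A_4$, which is irreducible. -/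

import Mathlib

open Matrix

/-- An element `A` of `GL(n, ℂ)` is a pseudo-reflection if it has finite order and its space of
fixed points (the kernel of `A - 1` on `ℂⁿ`) is a hyperplane. -/
def IsPseudoReflection {n : ℕ} (A : GL (Fin n) ℂ) : Prop :=
  IsOfFinOrder A ∧
    Module.finrank ℂ
      (LinearMap.ker (Matrix.toLin' (A : Matrix (Fin n) (Fin n) ℂ) - LinearMap.id)) + 1 = n

/-- A matrix group is small if it contains no pseudo-reflections. -/
def IsSmall {n : ℕ} (H : Subgroup (GL (Fin n) ℂ)) : Prop :=
  ∀ A ∈ H, ¬ IsPseudoReflection A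

/-- Conjugacy of matrix groups: `K = C H C⁻¹` for some `C` in `GL(n, ℂ)`. -/
def ConjugateInGL {n : ℕ} (H K : Subgroup (GL (Fin n) ℂ)) : Prop :=
  ∃ C : GL (Fin n) ℂ, H.map (MulAut.conj C).toMonoidHom = K

/-- The linear representation on `ℂⁿ` given by a homomorphism to `GL(n, ℂ)`. -/
noncomputable def linearRep {n : ℕ} {G : Type*} [Group G] (ρ : G →* GL (Fin n) ℂ) :
    Representation ℂ G (Fin n → ℂ) :=
  (Units.coeHom (Module.End ℂ (Fin n → ℂ))).comp
    (Matrix.GeneralLinearGroup.toLin.toMonoidHom.comp ρ)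

/-- The relators of `⟨a, x; a⁶ = 1, x² = a³, x⁻¹ a x = a⁻¹⟩`, with `a = of false`, `x = of true`. -/
def bd3Rels : Set (FreeGroup Bool) :=
  let a := FreeGroup.of false
  let x := FreeGroup.of true
  {a ^ 6, x ^ 2 * (a ^ 3)⁻¹, x⁻¹ * a * x * a}

/-- The binary dihedral group with 12 elements. -/
abbrev BD3 : Type := PresentedGroup bd3Rels

/-- The ten entries of the table, in order. -/
inductive Entry
  | s3 | d8 | q8₁ | q8₂ | d10 | d12 | a4 | bd3₁ | bd3₂ | bd3₃

namespace Entry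

/-- The abstract group of an entry (`DihedralGroup n` has `2n` elements, and `QuaternionGroup 2`
is the quaternion group with 8 elements). -/
def Model : Entry → Type
  | s3 => Equiv.Perm (Fin 3)
  | d8 => DihedralGroup 4
  | q8₁ | q8₂ => QuaternionGroup 2
  | d10 => DihedralGroup 5
  | d12 => DihedralGroup 6
  | a4 => alternatingGroup (Fin 4)
  | bd3₁ | bd3₂ | bd3₃ => BD3

instance instGroupModel : (k : Entry) → Group k.Model
  | s3 => inferInstanceAs (Group (Equiv.Perm (Fin 3)))
  | d8 => inferInstanceAs (Group (DihedralGroup 4))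
  | q8₁ | q8₂ => inferInstanceAs (Group (QuaternionGroup 2))
  | d10 => inferInstanceAs (Group (DihedralGroup 5))
  | d12 => inferInstanceAs (Group (DihedralGroup 6))
  | a4 => inferInstanceAs (Group (alternatingGroup (Fin 4)))
  | bd3₁ | bd3₂ | bd3₃ => inferInstanceAs (Group BD3)

/-- First generating matrix of an entry. -/
def matA (ζ₃ ζ₅ : ℂ) : Entry → Matrix (Fin 3) (Fin 3) ℂ
  | s3 => !![0, -1, 0; 1, -1, 0; 0, 0, 1]
  | d8 => !![0, -1, 0; 1, 0, 0; 0, 0, 1]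
  | q8₁ => !![Complex.I, 0, 0; 0, -Complex.I, 0; 0, 0, 1]
  | q8₂ => !![Complex.I, 0, 0; 0, -Complex.I, 0; 0, 0, -1]
  | d10 => !![ζ₅, 0, 0; 0, ζ₅ ^ 4, 0; 0, 0, 1]
  | d12 => !![-(ζ₃ ^ 2), 0, 0; 0, -ζ₃, 0; 0, 0, 1]
  | a4 => !![0, 0, 1; 1, 0, 0; 0, 1, 0]
  | bd3₁ => !![-(ζ₃ ^ 2), 0, 0; 0, -ζ₃, 0; 0, 0, 1]
  | bd3₂ => !![-(ζ₃ ^ 2), 0, 0; 0, -ζ₃, 0; 0, 0, -1]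
  | bd3₃ => !![-(ζ₃ ^ 2), 0, 0; 0, -ζ₃, 0; 0, 0, 1]

/-- Second generating matrix of an entry. -/
def matB : Entry → Matrix (Fin 3) (Fin 3) ℂ
  | s3 => !![-1, 1, 0; 0, 1, 0; 0, 0, -1]
  | d8 => !![1, 0, 0; 0, -1, 0; 0, 0, -1]
  | q8₁ => !![0, -1, 0; 1, 0, 0; 0, 0, 1]
  | q8₂ => !![0, -1, 0; 1, 0, 0; 0, 0, 1]
  | d10 => !![0, 1, 0; 1, 0, 0; 0, 0, -1]
  | d12 => !![0, 1, 0; 1, 0, 0; 0, 0, -1]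
  | a4 => !![-1, 0, 0; 0, -1, 0; 0, 0, 1]
  | bd3₁ => !![0, -Complex.I, 0; -Complex.I, 0, 0; 0, 0, 1]
  | bd3₂ => !![0, -Complex.I, 0; -Complex.I, 0, 0; 0, 0, Complex.I]
  | bd3₃ => !![0, -Complex.I, 0; -Complex.I, 0, 0; 0, 0, -1]

theorem det_matA_ne_zero {ζ₃ ζ₅ : ℂ} (h₃ : IsPrimitiveRoot ζ₃ 3) (h₅ : IsPrimitiveRoot ζ₅ 5)
    (k : Entry) : (k.matA ζ₃ ζ₅).det ≠ 0 := by
  have h3 : ζ₃ ≠ 0 := h₃.ne_zero (by norm_num)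
  have h5 : ζ₅ ≠ 0 := h₅.ne_zero (by norm_num)
  cases k <;> simp [matA, Matrix.det_fin_three, h3, h5]

theorem det_matB_ne_zero (k : Entry) : k.matB.det ≠ 0 := by
  cases k <;> simp [matB, Matrix.det_fin_three]

/-- First generator of an entry in `GL(3, ℂ)`. -/
noncomputable def genA {ζ₃ ζ₅ : ℂ} (h₃ : IsPrimitiveRoot ζ₃ 3) (h₅ : IsPrimitiveRoot ζ₅ 5)
    (k : Entry) : GL (Fin 3) ℂ :=
  Matrix.GeneralLinearGroup.mkOfDetNeZero (k.matA ζ₃ ζ₅) (k.det_matA_ne_zero h₃ h₅)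

/-- Second generator of an entry in `GL(3, ℂ)`. -/
noncomputable def genB (k : Entry) : GL (Fin 3) ℂ :=
  Matrix.GeneralLinearGroup.mkOfDetNeZero k.matB k.det_matB_ne_zero

/-- The subgroup of `GL(3, ℂ)` generated by the two matrices of an entry. -/
noncomputable def image {ζ₃ ζ₅ : ℂ} (h₃ : IsPrimitiveRoot ζ₃ 3) (h₅ : IsPrimitiveRoot ζ₅ 5)
    (k : Entry) : Subgroup (GL (Fin 3) ℂ) :=
  Subgroup.closure {k.genA h₃ h₅, k.genB}

end Entry

/-! A non-abelian group of order at most 12 is either A₄ or has order 2n with 3 ≤ n ≤ 6 and is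
generated by `a` of order n and `b` with `a * b * a = b` and `b ^ 2 = a ^ m`, where m = 0 (dihedral)
or n = 2m (dicyclic). This is `classification_of_card_le_twelve`.

In the second case let A, B be the images of `a`, `b` in GL(3). Since A² ≠ 1, A has an eigenvector v
with eigenvalue l ≠ ±1. Then Bv has eigenvalue l⁻¹, and det A = ±1 is the remaining eigenvalue, with
eigenvector w. The three eigenvalues are distinct and B preserves the line of w, so in the basis v,
Bv, w the pair is given by four numbers (l, μ, e, ν) with e = l^m and ν² = μ^m. This is `HasForm`;
equal parameters mean simultaneously conjugate pairs.

Smallness cuts the parameters down. It makes l a primitive n-th root of unity, and passing to a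
power of A then turns l into any prescribed one (`exists_hasForm_of_isSmall`). In the dihedral case
it also forces ν = -1 and μ = 1, one group for each n. In each dicyclic case four pairs (μ, ν)
remain; changing generators identifies three of them for Q₈ and two for BD₃, leaving two and three
groups. Every entry except A₄ has a normal form of its own, which matches it with this list and
shows that it is small.

For A₄ smallness is not needed: the Klein subgroup has a simultaneous eigenvector, whose translates
under a 3-cycle form a basis, so a faithful representation is unique up to conjugacy.

The entries are told apart by the group order, the number of solutions of g² = 1, and the
determinants of their elements. -/

/-! ### Dihedral and generalized quaternion groups from generators and relations -/

section Presentations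

variable {G : Type*} [Group G] {a b : G} {n : ℕ}

/-- The homomorphism `ZMod n → G` sending `1` to an element `a` with `a ^ n = 1`. -/
def zmodPowHom (a : G) (h : a ^ n = 1) : ZMod n →+ Additive G :=
  ZMod.lift n ⟨zmultiplesHom (Additive G) (Additive.ofMul a), by
    simp [← ofMul_pow, h]⟩

/-- The power of `a` with exponent in `ZMod n`. -/
def zmodPow (a : G) (h : a ^ n = 1) (i : ZMod n) : G := (zmodPowHom a h i).toMul

theorem zmodPow_add (h : a ^ n = 1) (i j : ZMod n) :
    zmodPow a h (i + j) = zmodPow a h i * zmodPow a h j := by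
  simp [zmodPow]

theorem zmodPow_intCast (h : a ^ n = 1) (i : ℤ) : zmodPow a h i = a ^ i := by
  simp [zmodPow, zmodPowHom]

theorem zmodPow_natCast (h : a ^ n = 1) (i : ℕ) : zmodPow a h i = a ^ i := by
  have := zmodPow_intCast h i
  simpa using this

theorem zmodPow_zero (h : a ^ n = 1) : zmodPow a h 0 = 1 := by
  simp [zmodPow]

theorem zmodPow_one (h : a ^ n = 1) : zmodPow a h 1 = a := by
  simpa using zmodPow_natCast h 1

theorem zmodPow_mem_zpowers (h : a ^ n = 1) (i : ZMod n) :
    zmodPow a h i ∈ Subgroup.zpowers a := by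
  obtain ⟨k, rfl⟩ := ZMod.intCast_surjective i
  rw [zmodPow_intCast]
  exact Subgroup.zpow_mem_zpowers a k

theorem zmodPow_eq_one (ha : orderOf a = n) (h : a ^ n = 1) {i : ZMod n}
    (hi : zmodPow a h i = 1) : i = 0 := by
  obtain ⟨k, rfl⟩ := ZMod.intCast_surjective i
  rw [zmodPow_intCast, ← orderOf_dvd_iff_zpow_eq_one, ha] at hi
  exact (ZMod.intCast_zmod_eq_zero_iff_dvd _ _).2 hi

theorem zpow_mul_of_inverts (hab : a * b * a = b) (k : ℤ) : a ^ k * b = b * a ^ (-k) := by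
  have h : SemiconjBy b a⁻¹ a := by
    rw [SemiconjBy, mul_inv_eq_iff_eq_mul, hab]
  have := (h.zpow_right k).eq
  rw [← this, _root_.zpow_neg, _root_.inv_zpow]

theorem zmodPow_mul_of_inverts (hab : a * b * a = b) (h : a ^ n = 1) (i : ZMod n) :
    zmodPow a h i * b = b * zmodPow a h (-i) := by
  obtain ⟨k, rfl⟩ := ZMod.intCast_surjective i
  rw [← Int.cast_neg, zmodPow_intCast, zmodPow_intCast, zpow_mul_of_inverts hab]

/-- A power of `a` commutes with `a`; being commuted with and inverted at once would give a² = 1. -/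
theorem notMem_zpowers_of_inverts (hab : a * b * a = b) (ha : 3 ≤ orderOf a) :
    b ∉ Subgroup.zpowers a := by
  rintro ⟨k, rfl⟩
  have h2 : a ^ 2 = 1 := by
    have h : a ^ 2 * a ^ k = a ^ k := by
      calc a ^ 2 * a ^ k = a * a ^ k * a := by
            rw [pow_two, mul_assoc, mul_assoc, (Commute.self_zpow a k).eq]
        _ = a ^ k := hab
    simpa using h
  have := Nat.le_of_dvd two_pos (orderOf_dvd_of_pow_eq_one h2)
  omega

theorem not_commute_of_inverts (hab : a * b * a = b) (ha : 3 ≤ orderOf a) : a * b ≠ b * a := by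
  intro h
  have h2 : a ^ 2 = 1 := by
    rw [h, mul_assoc] at hab
    simpa [pow_two] using hab
  have := Nat.le_of_dvd two_pos (orderOf_dvd_of_pow_eq_one h2)
  omega

/-- The homomorphism from a dihedral group given by two elements satisfying its relations. -/
def dihedralHom (a b : G) (h : a ^ n = 1) (hab : a * b * a = b) (hb : b ^ 2 = 1) :
    DihedralGroup n →* G :=
  MonoidHom.mk' (fun x => match x with
    | .r i => zmodPow a h i
    | .sr i => b * zmodPow a h i) (by
    have hbb : b * b = 1 := by rw [← pow_two, hb]
    rintro (i | i) (j | j)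
    · simp [zmodPow_add]
    · simp only [DihedralGroup.r_mul_sr]
      rw [← mul_assoc, zmodPow_mul_of_inverts hab, mul_assoc, ← zmodPow_add, neg_add_eq_sub]
    · simp [zmodPow_add, mul_assoc]
    · simp only [DihedralGroup.sr_mul_sr]
      rw [mul_assoc, ← mul_assoc _ b, zmodPow_mul_of_inverts hab, mul_assoc, ← zmodPow_add,
        ← mul_assoc, hbb, one_mul, neg_add_eq_sub])

/-- The homomorphism from a generalized quaternion group given by two elements satisfying its
relations. -/
def quaternionHom (a b : G) (h : a ^ (2 * n) = 1) (hab : a * b * a = b) (hb : b ^ 2 = a ^ n) :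
    QuaternionGroup n →* G :=
  MonoidHom.mk' (fun x => match x with
    | .a i => zmodPow a h i
    | .xa i => b * zmodPow a h i) (by
    have hbb : b * b = zmodPow a h (n : ZMod (2 * n)) := by rw [← pow_two, hb, zmodPow_natCast]
    rintro (i | i) (j | j)
    · simp [zmodPow_add]
    · simp only [QuaternionGroup.a_mul_xa]
      rw [← mul_assoc, zmodPow_mul_of_inverts hab, mul_assoc, ← zmodPow_add, neg_add_eq_sub]
    · simp [zmodPow_add, mul_assoc]
    · simp only [QuaternionGroup.xa_mul_xa]
      rw [mul_assoc, ← mul_assoc _ b, zmodPow_mul_of_inverts hab, mul_assoc, ← zmodPow_add,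
        ← mul_assoc, hbb, ← zmodPow_add, neg_add_eq_sub, add_sub_assoc])

/-- The homomorphism is injective on rotations because the order of `a` is exactly n, and no
reflection maps to 1 because `b` lies outside the powers of `a`. -/
theorem nonempty_dihedralGroup_equiv_closure (ha : orderOf a = n) (hn : 3 ≤ n)
    (hab : a * b * a = b) (hb : b ^ 2 = 1) :
    Nonempty (DihedralGroup n ≃* Subgroup.closure {a, b}) := by
  have h : a ^ n = 1 := ha ▸ pow_orderOf_eq_one a
  let f := dihedralHom a b h hab hb
  have hr : ∀ i, f (.r i) = zmodPow a h i := fun _ => rfl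
  have hs : ∀ i, f (.sr i) = b * zmodPow a h i := fun _ => rfl
  have hinj : Function.Injective f := by
    refine (injective_iff_map_eq_one f).2 ?_
    rintro (i | i) hi
    · rw [zmodPow_eq_one ha h ((hr i).symm.trans hi)]; rfl
    · exfalso
      refine notMem_zpowers_of_inverts hab (ha ▸ hn) ?_
      rw [hs, mul_eq_one_iff_eq_inv] at hi
      rw [hi]
      exact inv_mem (zmodPow_mem_zpowers h i)
  have hrange : f.range = Subgroup.closure {a, b} := by
    refine le_antisymm ?_ ?_
    · rintro _ ⟨i | i, rfl⟩
      all_goals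
        have ha' : Subgroup.zpowers a ≤ Subgroup.closure {a, b} := by
          rw [Subgroup.zpowers_le]; exact Subgroup.subset_closure (by simp)
      · exact ha' (zmodPow_mem_zpowers h i)
      · exact mul_mem (Subgroup.subset_closure (by simp)) (ha' (zmodPow_mem_zpowers h i))
    · rw [Subgroup.closure_le]
      rintro _ (rfl | rfl)
      · exact ⟨.r 1, by rw [hr, zmodPow_one]⟩
      · exact ⟨.sr 0, by rw [hs, zmodPow_zero, mul_one]⟩
  exact ⟨(MonoidHom.ofInjective hinj).trans (MulEquiv.subgroupCongr hrange)⟩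

theorem nonempty_quaternionGroup_equiv_closure (ha : orderOf a = 2 * n) (hn : 2 ≤ n)
    (hab : a * b * a = b) (hb : b ^ 2 = a ^ n) :
    Nonempty (QuaternionGroup n ≃* Subgroup.closure {a, b}) := by
  have h : a ^ (2 * n) = 1 := ha ▸ pow_orderOf_eq_one a
  let f := quaternionHom a b h hab hb
  have hr : ∀ i, f (.a i) = zmodPow a h i := fun _ => rfl
  have hs : ∀ i, f (.xa i) = b * zmodPow a h i := fun _ => rfl
  have hinj : Function.Injective f := by
    refine (injective_iff_map_eq_one f).2 ?_
    rintro (i | i) hi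
    · rw [zmodPow_eq_one ha h ((hr i).symm.trans hi)]; rfl
    · exfalso
      refine notMem_zpowers_of_inverts hab (by omega) ?_
      rw [hs, mul_eq_one_iff_eq_inv] at hi
      rw [hi]
      exact inv_mem (zmodPow_mem_zpowers h i)
  have hrange : f.range = Subgroup.closure {a, b} := by
    refine le_antisymm ?_ ?_
    · rintro _ ⟨i | i, rfl⟩
      all_goals
        have ha' : Subgroup.zpowers a ≤ Subgroup.closure {a, b} := by
          rw [Subgroup.zpowers_le]; exact Subgroup.subset_closure (by simp)
      · exact ha' (zmodPow_mem_zpowers h i)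
      · exact mul_mem (Subgroup.subset_closure (by simp)) (ha' (zmodPow_mem_zpowers h i))
    · rw [Subgroup.closure_le]
      rintro _ (rfl | rfl)
      · exact ⟨.a 1, by rw [hr, zmodPow_one]⟩
      · exact ⟨.xa 0, by rw [hs, zmodPow_zero, mul_one]⟩
  exact ⟨(MonoidHom.ofInjective hinj).trans (MulEquiv.subgroupCongr hrange)⟩

/-- Serves the dihedral relations (m = 0) and the dicyclic ones together: the elements of these two
shapes are closed under products and inverses. -/
theorem exists_zpow_of_mem_closure_pair {m : ℕ} (hab : a * b * a = b) (hb : b ^ 2 = a ^ m) {g : G}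
    (hg : g ∈ Subgroup.closure {a, b}) : ∃ k : ℤ, g = a ^ k ∨ g = b * a ^ k := by
  have hbb : b * b = a ^ (m : ℤ) := by rw [← pow_two, hb, zpow_natCast]
  have hbi : b⁻¹ = b * a ^ (-(m : ℤ)) := by
    rw [inv_eq_iff_mul_eq_one, ← mul_assoc, hbb, ← _root_.zpow_add]; simp
  have hz := zpow_mul_of_inverts hab
  induction hg using Subgroup.closure_induction with
  | mem x hx =>
    rcases hx with rfl | rfl
    · exact ⟨1, Or.inl (by simp)⟩
    · exact ⟨0, Or.inr (by simp)⟩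
  | one => exact ⟨0, Or.inl (by simp)⟩
  | mul x y _ _ hx hy =>
    obtain ⟨i, rfl | rfl⟩ := hx <;> obtain ⟨j, rfl | rfl⟩ := hy
    · exact ⟨i + j, Or.inl (_root_.zpow_add ..).symm⟩
    · exact ⟨-i + j, Or.inr (by rw [← mul_assoc, hz, mul_assoc, ← _root_.zpow_add])⟩
    · exact ⟨i + j, Or.inr (by rw [mul_assoc, ← _root_.zpow_add])⟩
    · exact ⟨m + (-i + j), Or.inl (by
        rw [mul_assoc, ← mul_assoc _ b, hz, mul_assoc, ← mul_assoc, hbb, _root_.zpow_add, _root_.zpow_add])⟩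
  | inv x _ hx =>
    obtain ⟨i, rfl | rfl⟩ := hx
    · exact ⟨-i, Or.inl (_root_.zpow_neg ..).symm⟩
    · refine ⟨i + -(m : ℤ), Or.inr ?_⟩
      rw [_root_.mul_inv_rev, hbi, ← _root_.zpow_neg, ← mul_assoc, hz, mul_assoc, ← _root_.zpow_add, neg_neg]

end Presentations

/-- The point is that `a` has order exactly 6 in the presented group. This is seen in the quotient:
the relators hold in `QuaternionGroup 3`, where the image of `a` has order 6. -/
theorem nonempty_quaternionGroup_equiv_bd3 : Nonempty (QuaternionGroup 3 ≃* BD3) := by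
  let a : BD3 := PresentedGroup.of false
  let x : BD3 := PresentedGroup.of true
  have hrel : ∀ r ∈ bd3Rels, PresentedGroup.mk bd3Rels r = 1 :=
    fun r hr => PresentedGroup.one_of_mem hr
  have h1 : a ^ 6 = 1 := hrel (FreeGroup.of false ^ 6) (by simp [bd3Rels])
  have h2 : x ^ 2 * (a ^ 3)⁻¹ = 1 :=
    hrel (FreeGroup.of true ^ 2 * (FreeGroup.of false ^ 3)⁻¹) (by simp [bd3Rels])
  have h3 : x⁻¹ * a * x * a = 1 :=
    hrel ((FreeGroup.of true)⁻¹ * FreeGroup.of false * FreeGroup.of true * FreeGroup.of false)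
      (by simp [bd3Rels])
  have hx : x ^ 2 = a ^ 3 := by rwa [mul_inv_eq_one] at h2
  have hax : a * x * a = x := by
    rw [mul_assoc, mul_assoc, inv_mul_eq_one] at h3
    rw [mul_assoc]; exact h3.symm
  let F : Bool → QuaternionGroup 3 := fun t => bif t then .xa 0 else .a 1
  have hF : ∀ r ∈ bd3Rels, FreeGroup.lift F r = 1 := by
    intro r hr
    simp only [bd3Rels, Set.mem_insert_iff, Set.mem_singleton_iff] at hr
    rcases hr with rfl | rfl | rfl <;> simp [F] <;> decide
  let f : BD3 →* QuaternionGroup 3 := PresentedGroup.toGroup hF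
  have hfa : f a = .a 1 := by simp [f, a, F]
  have ho : orderOf a = 2 * 3 := by
    refine Nat.dvd_antisymm (orderOf_dvd_of_pow_eq_one h1) ?_
    have := orderOf_map_dvd f a
    rwa [hfa, QuaternionGroup.orderOf_a_one] at this
  obtain ⟨e⟩ := nonempty_quaternionGroup_equiv_closure ho (by norm_num) hax hx
  have htop : Subgroup.closure {a, x} = ⊤ := by
    rw [eq_top_iff, ← PresentedGroup.closure_range_of bd3Rels]
    refine Subgroup.closure_mono ?_
    rintro _ ⟨t, rfl⟩
    cases t
    · exact Or.inl rfl
    · exact Or.inr rfl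
  exact ⟨e.trans ((MulEquiv.subgroupCongr htop).trans Subgroup.topEquiv)⟩

theorem nonempty_dihedralGroup_three_equiv_perm :
    Nonempty (DihedralGroup 3 ≃* Equiv.Perm (Fin 3)) := by
  have ha : orderOf (finRotate 3) = 3 := orderOf_eq_prime (by decide) (by decide)
  obtain ⟨e⟩ := nonempty_dihedralGroup_equiv_closure (a := finRotate 3) (b := Equiv.swap 0 1) ha
    le_rfl (by decide) (by decide)
  have htop : Subgroup.closure {finRotate 3, Equiv.swap 0 1} = ⊤ := by
    apply Subgroup.eq_top_of_card_eq
    rw [← Nat.card_congr e.toEquiv, DihedralGroup.nat_card, Nat.card_eq_fintype_card]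
    decide
  exact ⟨e.trans ((MulEquiv.subgroupCongr htop).trans Subgroup.topEquiv)⟩

/-! ### Non-abelian groups of order at most 12 -/

section Classification

variable {G : Type*} [Group G]

/-- The powers of `a` form a normal subgroup of index 2, so an outside element `b` acts on it by an
exponent k with k² = 1 in `ZMod n`, and b² is a power of `a` fixed by that action. -/
theorem dihedral_or_dicyclic_relations [Finite G] {n : ℕ} (hn : 3 ≤ n) (hn' : n ≤ 6)
    (hcard : Nat.card G = 2 * n) {a : G} (ha : orderOf a = n) (hG : ∃ x y : G, x * y ≠ y * x) :
    ∃ (b : G) (m : ℕ), a * b * a = b ∧ b ^ 2 = a ^ m ∧ (m = 0 ∨ n = 2 * m) := by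
  have hidx : (Subgroup.zpowers a).index = 2 := by
    have := Subgroup.card_mul_index (Subgroup.zpowers a)
    rw [Nat.card_zpowers, ha, hcard, mul_comm] at this
    exact Nat.eq_of_mul_eq_mul_right (by omega) this
  have hnormal := Subgroup.normal_of_index_eq_two hidx
  -- If `a` were central, G would be a central subgroup together with one further coset, hence
  -- abelian.
  obtain ⟨b, hb⟩ : ∃ b, ¬ Commute a b := by
    by_contra! hc
    obtain ⟨x, y, hxy⟩ := hG
    have hpow : ∀ {z : G}, z ∈ Subgroup.zpowers a → ∀ w, Commute z w := by
      rintro _ ⟨k, rfl⟩ w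
      exact (hc w).zpow_left k
    have hx : x ∉ Subgroup.zpowers a := fun h => hxy (hpow h y)
    have hy : y ∉ Subgroup.zpowers a := fun h => hxy (hpow h x).symm
    have hxy' : x⁻¹ * y ∈ Subgroup.zpowers a := by
      rw [Subgroup.mul_mem_iff_of_index_two hidx, inv_mem_iff]
      exact iff_of_false hx hy
    apply hxy
    have := (hpow hxy' x).eq
    rw [mul_inv_cancel_left] at this
    calc x * y = x * (x⁻¹ * y * x) := by rw [this]
      _ = y * x := by simp [mul_assoc]
  obtain ⟨k, hk⟩ : ∃ k : ℤ, a ^ k = b * a * b⁻¹ :=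
    hnormal.conj_mem a (Subgroup.mem_zpowers a) b
  obtain ⟨j, hj⟩ : ∃ j : ℕ, a ^ j = b * b :=
    mem_powers_iff_mem_zpowers.2 (Subgroup.mul_self_mem_of_index_two hidx b)
  have hsemi : SemiconjBy b a (a ^ k) := by
    rw [SemiconjBy, hk]; group
  -- Conjugating twice by `b` is conjugating by b², a power of `a`, which fixes `a`.
  have hkk : (k : ZMod n) * k = 1 := by
    have h1 : a ^ (k * k) = a := by
      have h2 : SemiconjBy (b * b) a (a ^ (k * k)) := by
        have := (hsemi.zpow_right k).mul_left hsemi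
        rwa [← _root_.zpow_mul] at this
      rw [← hj] at h2
      have h3 := h2.eq
      rw [← (Commute.self_pow a j).eq] at h3
      exact (mul_right_cancel h3).symm
    have h2 : a ^ (k * k - 1) = 1 := by rw [_root_.zpow_sub, h1]; simp
    rw [← orderOf_dvd_iff_zpow_eq_one, ha, ← ZMod.intCast_zmod_eq_zero_iff_dvd] at h2
    push_cast at h2
    exact sub_eq_zero.1 h2
  have hk1 : (k : ZMod n) = 1 ∨ (k : ZMod n) = -1 := by
    revert hkk
    generalize (k : ZMod n) = c
    clear * - hn hn'
    -- For 3 ≤ n ≤ 6 the only square roots of 1 modulo n are ±1.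
    interval_cases n <;> revert c <;> decide
  have hab : a * b * a = b := by
    rcases hk1 with h | h
    · exfalso
      have h1 : a ^ (k - 1) = 1 := by
        rw [← orderOf_dvd_iff_zpow_eq_one, ha, ← ZMod.intCast_zmod_eq_zero_iff_dvd]
        push_cast
        rw [h, sub_self]
      rw [_root_.zpow_sub, zpow_one, mul_inv_eq_one] at h1
      rw [h1] at hsemi
      exact hb hsemi.symm
    · have h1 : a ^ (k + 1) = 1 := by
        rw [← orderOf_dvd_iff_zpow_eq_one, ha, ← ZMod.intCast_zmod_eq_zero_iff_dvd]
        push_cast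
        rw [h, neg_add_cancel]
      rw [_root_.zpow_add, zpow_one, mul_eq_one_iff_eq_inv] at h1
      have := hsemi.eq
      rw [mul_assoc, this, h1]
      simp
  -- The power b² = a^j is inverted by `b` but also commutes with it, so it equals its own inverse.
  have hjj : n ∣ 2 * j := by
    rw [← ha, orderOf_dvd_iff_pow_eq_one]
    have h1 := zpow_mul_of_inverts hab j
    have h2 : b * a ^ (j : ℤ) = a ^ (j : ℤ) * b := by
      rw [zpow_natCast, hj, mul_assoc]
    rw [← h2] at h1
    have h3 := mul_left_cancel h1
    rw [_root_.zpow_neg, ← mul_eq_one_iff_eq_inv, zpow_natCast, ← pow_add] at h3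
    rw [two_mul, h3]
  refine ⟨b, j % n, hab, ?_, ?_⟩
  · rw [pow_two, ← hj, ← ha, pow_mod_orderOf]
  · have : j % n < n := Nat.mod_lt _ (by omega)
    have h2 : n ∣ 2 * (j % n) := by
      rw [Nat.dvd_iff_mod_eq_zero] at hjj ⊢
      rw [← hjj, Nat.mul_mod_mod]
    obtain ⟨c, hc⟩ := h2
    have : c < 2 := by
      by_contra! h
      nlinarith
    interval_cases c <;> omega

/-- G acts on the four cosets of the subgroup generated by `c`. The kernel is the normal core, which
is trivial because a proper subgroup of a group of order 3 is; the image then has index 2 in S₄. -/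
theorem nonempty_equiv_alternatingGroup_of_not_normal [Finite G] (hcard : Nat.card G = 12) {c : G}
    (hc : orderOf c = 3) (hn : ¬ (Subgroup.zpowers c).Normal) :
    Nonempty (G ≃* alternatingGroup (Fin 4)) := by
  set H := Subgroup.zpowers c with hH
  have hHcard : Nat.card H = 3 := by rw [hH, Nat.card_zpowers, hc]
  have hidx : Nat.card (G ⧸ H) = 4 := by
    have := Subgroup.card_mul_index H
    rw [hHcard, hcard, Subgroup.index] at this
    omega
  have hker : (MulAction.toPermHom G (G ⧸ H)).ker = ⊥ := by
    rw [← Subgroup.normalCore_eq_ker]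
    have hdvd := Subgroup.card_dvd_of_le H.normalCore_le
    rw [hHcard, Nat.dvd_prime Nat.prime_three] at hdvd
    rcases hdvd with h | h
    · exact Subgroup.eq_bot_of_card_eq _ h
    · exfalso
      apply hn
      have := Subgroup.eq_of_le_of_card_ge H.normalCore_le (by rw [h, hHcard])
      rw [← this]
      exact H.normalCore_normal
  have hinj := (MonoidHom.ker_eq_bot_iff _).1 hker
  obtain ⟨e⟩ : Nonempty ((G ⧸ H) ≃ Fin 4) := ⟨Finite.equivFinOfCardEq hidx⟩
  let f : G →* Equiv.Perm (Fin 4) := e.permCongrHom.toMonoidHom.comp (MulAction.toPermHom G (G ⧸ H))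
  have hf : Function.Injective f := e.permCongrHom.injective.comp hinj
  have hrange : f.range = alternatingGroup (Fin 4) := by
    apply Equiv.Perm.eq_alternatingGroup_of_index_eq_two
    have := Subgroup.card_mul_index f.range
    rw [← Nat.card_congr (MonoidHom.ofInjective hf).toEquiv, hcard, Nat.card_perm] at this
    simp [Nat.factorial] at this
    omega
  exact ⟨(MonoidHom.ofInjective hf).trans (MulEquiv.subgroupCongr hrange)⟩

/-- Conjugation sends `c` to `c` or its inverse, so the centralizer of `c` has index at most 2 and
even order. It contains an involution, whose product with `c` has order 6. -/
theorem exists_orderOf_eq_six_of_normal [Finite G] (hcard : Nat.card G = 12) {c : G}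
    (hc : orderOf c = 3) (hn : (Subgroup.zpowers c).Normal) : ∃ a : G, orderOf a = 6 := by
  have hconj : ∀ g : G, g * c * g⁻¹ = c ∨ g * c * g⁻¹ = c⁻¹ := by
    intro g
    obtain ⟨k, hk⟩ := (mem_powers_iff_mem_zpowers (x := c)).2
      (hn.conj_mem c (Subgroup.mem_zpowers c) g)
    simp only at hk
    rw [← pow_mod_orderOf, hc] at hk
    have : k % 3 < 3 := Nat.mod_lt _ (by norm_num)
    rw [← hk]
    interval_cases k % 3
    · exfalso
      rw [pow_zero, eq_comm, conj_eq_one_iff] at hk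
      simp [hk] at hc
    · exact Or.inl (pow_one c)
    · right
      rw [eq_inv_iff_mul_eq_one, ← pow_succ, ← orderOf_dvd_iff_pow_eq_one, hc]
  let K := Subgroup.centralizer {c}
  have hK : ∀ {g : G}, g ∈ K ↔ g * c * g⁻¹ = c := by
    intro g
    rw [Subgroup.mem_centralizer_singleton_iff, mul_inv_eq_iff_eq_mul]
  have heven : 2 ∣ Nat.card K := by
    by_cases htop : K = ⊤
    · rw [htop, Subgroup.card_top, hcard]; norm_num
    -- Elements outside the centralizer invert `c`, and the product of two inverting elements
    -- centralizes it.
    · have hidx : K.index = 2 := by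
        rw [Subgroup.index_eq_two_iff]
        obtain ⟨x, hx⟩ : ∃ x, x ∉ K := by
          by_contra! h
          exact htop ((Subgroup.eq_top_iff' K).2 h)
        refine ⟨x, fun g => ?_⟩
        have hx' := (hconj x).resolve_left (fun h => hx (hK.2 h))
        have hcc : c⁻¹ ≠ c := by
          intro h
          have h2 : c ^ 2 = 1 := by rw [pow_two]; nth_rewrite 1 [← h]; simp
          have := orderOf_dvd_of_pow_eq_one h2
          rw [hc] at this
          omega
        have hgx : g * x * c * (g * x)⁻¹ = (g * c * g⁻¹)⁻¹ := by
          calc g * x * c * (g * x)⁻¹ = g * (x * c * x⁻¹) * g⁻¹ := by group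
            _ = _ := by rw [hx']; group
        rw [hK, hK, hgx]
        rcases hconj g with h | h
        · rw [h]; exact Or.inr ⟨rfl, hcc⟩
        · rw [h, inv_inv]; exact Or.inl ⟨rfl, hcc⟩
      have := Subgroup.card_mul_index K
      rw [hidx, hcard] at this
      omega
  obtain ⟨⟨z, hz⟩, hz2⟩ := exists_prime_orderOf_dvd_card' 2 heven
  rw [Subgroup.orderOf_mk] at hz2
  have hcomm : Commute z c := Subgroup.mem_centralizer_singleton_iff.1 hz
  refine ⟨z * c, ?_⟩
  rw [hcomm.orderOf_mul_eq_mul_orderOf_of_coprime (by rw [hz2, hc]; norm_num), hz2, hc]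

theorem mul_comm_of_card_eq_prime {p : ℕ} (hp : p.Prime) (h : Nat.card G = p) (x y : G) :
    x * y = y * x := by
  have := Fact.mk hp
  have := isCyclic_of_prime_card h
  exact (IsCyclic.isMulCommutative (α := G)).is_comm.comm x y

theorem mul_comm_of_card_eq_prime_sq {p : ℕ} (hp : p.Prime) (h : Nat.card G = p ^ 2) (x y : G) :
    x * y = y * x := by
  have := Fact.mk hp
  exact (IsPGroup.isMulCommutative_of_card_eq_prime_sq h).is_comm.comm x y

theorem exists_orderOf_eq_four_of_card_eq_eight [Finite G] (hcard : Nat.card G = 8)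
    (hG : ∃ x y : G, x * y ≠ y * x) : ∃ a : G, orderOf a = 4 := by
  obtain ⟨x, y, hxy⟩ := hG
  obtain ⟨a, ha⟩ : ∃ a : G, a ^ 2 ≠ 1 := by
    by_contra! h
    apply hxy
    have hi : ∀ z : G, z⁻¹ = z := fun z => by
      rw [inv_eq_iff_mul_eq_one, ← pow_two, h]
    rw [← hi (x * y), _root_.mul_inv_rev, hi, hi]
  refine ⟨a, ?_⟩
  have hdvd := orderOf_dvd_natCard a
  rw [hcard] at hdvd
  have hle := Nat.le_of_dvd (by norm_num) hdvd
  have h0 : orderOf a ≠ 1 := fun h => ha (by rw [orderOf_eq_one_iff.1 h, one_pow])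
  have h2 : orderOf a ≠ 2 := fun h => ha (by rw [← h, pow_orderOf_eq_one])
  have h8 : orderOf a ≠ 8 := fun h => by
    have := isCyclic_of_orderOf_eq_card a (by rw [h, hcard])
    exact hxy ((IsCyclic.isMulCommutative (α := G)).is_comm.comm x y)
  interval_cases orderOf a <;> omega

/-- A non-abelian group of order at most `12` is dihedral or dicyclic, given by generators and
relations, or alternating of degree `4`. -/
theorem classification_of_card_le_twelve [Finite G] (hcard : Nat.card G ≤ 12)
    (hG : ∃ x y : G, x * y ≠ y * x) :
    (∃ (n m : ℕ) (a b : G), 3 ≤ n ∧ n ≤ 6 ∧ Nat.card G = 2 * n ∧ orderOf a = n ∧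
      a * b * a = b ∧ b ^ 2 = a ^ m ∧ (m = 0 ∨ n = 2 * m)) ∨
    Nonempty (G ≃* alternatingGroup (Fin 4)) := by
  have hpos : 0 < Nat.card G := Nat.card_pos
  obtain ⟨x, y, hxy⟩ := hG
  have key : ∀ n, 3 ≤ n → n ≤ 6 → Nat.card G = 2 * n → (∃ a : G, orderOf a = n) →
      ∃ (n m : ℕ) (a b : G), 3 ≤ n ∧ n ≤ 6 ∧ Nat.card G = 2 * n ∧ orderOf a = n ∧
      a * b * a = b ∧ b ^ 2 = a ^ m ∧ (m = 0 ∨ n = 2 * m) := by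
    rintro n h3 h6 hc ⟨a, ha⟩
    obtain ⟨b, m, h⟩ := dihedral_or_dicyclic_relations h3 h6 hc ha ⟨x, y, hxy⟩
    exact ⟨n, m, a, b, h3, h6, hc, ha, h⟩
  have hprime : ∀ p, p.Prime → Nat.card G ≠ p := fun p hp h =>
    hxy (mul_comm_of_card_eq_prime hp h x y)
  have hsq : ∀ p, p.Prime → Nat.card G ≠ p ^ 2 := fun p hp h =>
    hxy (mul_comm_of_card_eq_prime_sq hp h x y)
  have h1 : Nat.card G ≠ 1 := fun h => by
    have := (Nat.card_eq_one_iff_unique.1 h).1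
    exact hxy (Subsingleton.elim _ _)
  have hcases : Nat.card G = 6 ∨ Nat.card G = 8 ∨ Nat.card G = 10 ∨ Nat.card G = 12 := by
    have := hprime 2 (by norm_num)
    have := hprime 3 (by norm_num)
    have := hprime 5 (by norm_num)
    have := hprime 7 (by norm_num)
    have := hprime 11 (by norm_num)
    have := hsq 2 (by norm_num)
    have := hsq 3 (by norm_num)
    omega
  rcases hcases with h | h | h | h
  · exact Or.inl (key 3 (by norm_num) (by norm_num) h
      (have := Fact.mk Nat.prime_three; exists_prime_orderOf_dvd_card' 3 (by rw [h]; norm_num)))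
  · exact Or.inl (key 4 (by norm_num) (by norm_num) h
      (exists_orderOf_eq_four_of_card_eq_eight h ⟨x, y, hxy⟩))
  · exact Or.inl (key 5 (by norm_num) (by norm_num) h
      (have := Fact.mk Nat.prime_five; exists_prime_orderOf_dvd_card' 5 (by rw [h]; norm_num)))
  · obtain ⟨c, hc⟩ : ∃ c : G, orderOf c = 3 :=
      have := Fact.mk Nat.prime_three
      exists_prime_orderOf_dvd_card' 3 (by rw [h]; norm_num)
    by_cases hn : (Subgroup.zpowers c).Normal
    · exact Or.inl (key 6 (by norm_num) le_rfl h (exists_orderOf_eq_six_of_normal h hc hn))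
    · exact Or.inr (nonempty_equiv_alternatingGroup_of_not_normal h hc hn)

end Classification

/-! ### Pseudo-reflections through the rank of A - 1 -/

section PseudoReflections

theorem Matrix.le_rank_of_det_submatrix_ne_zero {m n k : ℕ} {M : Matrix (Fin m) (Fin n) ℂ}
    (r : Fin k → Fin m) (c : Fin k → Fin n) (h : (M.submatrix r c).det ≠ 0) : k ≤ M.rank := by
  have h1 := rank_of_isUnit _ ((Matrix.isUnit_iff_isUnit_det _).2 h.isUnit)
  have h2 := M.rank_submatrix_le r c
  rw [h1, Fintype.card_fin] at h2
  exact h2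

theorem Matrix.one_le_rank_of_ne_zero {m n : ℕ} {M : Matrix (Fin m) (Fin n) ℂ} (i : Fin m)
    (j : Fin n) (h : M i j ≠ 0) : 1 ≤ M.rank :=
  le_rank_of_det_submatrix_ne_zero (k := 1) (fun _ => i) (fun _ => j) (by rwa [det_fin_one])

theorem Matrix.two_le_rank_of_minor_ne_zero {m n : ℕ} {M : Matrix (Fin m) (Fin n) ℂ} (i i' : Fin m)
    (j j' : Fin n) (h : M i j * M i' j' - M i j' * M i' j ≠ 0) : 2 ≤ M.rank :=
  le_rank_of_det_submatrix_ne_zero ![i, i'] ![j, j'] (by rwa [det_fin_two])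

/-- Rank-nullity gives a criterion that is invariant under change of basis and is refuted by a
single nonzero 2 × 2 minor of A - 1. -/
theorem isPseudoReflection_iff_rank {n : ℕ} (A : GL (Fin n) ℂ) :
    IsPseudoReflection A ↔
      IsOfFinOrder A ∧ ((A : Matrix (Fin n) (Fin n) ℂ) - 1).rank = 1 := by
  unfold IsPseudoReflection
  refine and_congr_right fun _ => ?_
  have h : Matrix.toLin' (A : Matrix (Fin n) (Fin n) ℂ) - LinearMap.id =
      Matrix.toLin' ((A : Matrix (Fin n) (Fin n) ℂ) - 1) := by
    rw [map_sub, Matrix.toLin'_one]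
  rw [h]
  have := LinearMap.finrank_range_add_finrank_ker
    (Matrix.toLin' ((A : Matrix (Fin n) (Fin n) ℂ) - 1))
  rw [Module.finrank_fin_fun] at this
  rw [Matrix.rank, ← Matrix.toLin'_apply']
  omega

theorem rank_sub_one_eq_of_mul_eq_mul {n : ℕ} {A C : GL (Fin n) ℂ} {M : Matrix (Fin n) (Fin n) ℂ}
    (h : (A : Matrix (Fin n) (Fin n) ℂ) * C = C * M) :
    ((A : Matrix (Fin n) (Fin n) ℂ) - 1).rank = (M - 1).rank := by
  have hC : IsUnit (C : Matrix (Fin n) (Fin n) ℂ).det :=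
    (Matrix.isUnit_iff_isUnit_det _).1 C.isUnit
  rw [← rank_mul_eq_left_of_isUnit_det _ _ hC, ← rank_mul_eq_right_of_isUnit_det _ (M - 1) hC,
    sub_mul, mul_sub, h, one_mul, mul_one]

theorem IsPseudoReflection.conj {n : ℕ} {A : GL (Fin n) ℂ} (h : IsPseudoReflection A)
    (C : GL (Fin n) ℂ) : IsPseudoReflection (C * A * C⁻¹) := by
  rw [isPseudoReflection_iff_rank] at h ⊢
  refine ⟨(MulAut.conj C).toMonoidHom.isOfFinOrder h.1, ?_⟩
  rw [← h.2]
  refine rank_sub_one_eq_of_mul_eq_mul (C := C) ?_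
  rw [← Units.val_mul, ← Units.val_mul, inv_mul_cancel_right]

theorem IsSmall.of_conjugate {n : ℕ} {H K : Subgroup (GL (Fin n) ℂ)} (h : ConjugateInGL H K)
    (hH : IsSmall H) : IsSmall K := by
  obtain ⟨C, rfl⟩ := h
  rintro _ ⟨A, hA, rfl⟩ hpr
  apply hH A hA
  have := hpr.conj C⁻¹
  simpa [mul_assoc] using this

theorem ConjugateInGL.nonempty_equiv {n : ℕ} {H K : Subgroup (GL (Fin n) ℂ)}
    (h : ConjugateInGL H K) : Nonempty (H ≃* K) := by
  obtain ⟨C, rfl⟩ := h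
  exact ⟨H.equivMapOfInjective _ (MulAut.conj C).injective⟩

end PseudoReflections

/-! ### The normal form of a dihedral or dicyclic pair -/

section NormalForm

/-- The matrix `diag(l, l⁻¹, μ)`. -/
noncomputable def diagForm (l μ : ℂ) : Matrix (Fin 3) (Fin 3) ℂ := !![l, 0, 0; 0, l⁻¹, 0; 0, 0, μ]

/-- The matrix exchanging the first two axes up to a factor `e` and acting by `ν` on the third. -/
def swapForm (e ν : ℂ) : Matrix (Fin 3) (Fin 3) ℂ := !![0, e, 0; 1, 0, 0; 0, 0, ν]

theorem diagForm_mul (l l' μ μ' : ℂ) :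
    diagForm l μ * diagForm l' μ' = diagForm (l * l') (μ * μ') := by
  ext i j
  fin_cases i <;> fin_cases j <;> simp [diagForm, Matrix.mul_apply, Fin.sum_univ_three, mul_comm]

theorem diagForm_one : diagForm 1 1 = 1 := by
  ext i j
  fin_cases i <;> fin_cases j <;> simp [diagForm]

theorem diagForm_pow (l μ : ℂ) (k : ℕ) : diagForm l μ ^ k = diagForm (l ^ k) (μ ^ k) := by
  induction k with
  | zero => simp [diagForm_one]
  | succ k ih => rw [pow_succ, ih, diagForm_mul, pow_succ, pow_succ]

theorem diagForm_eq_one_iff {l μ : ℂ} : diagForm l μ = 1 ↔ l = 1 ∧ μ = 1 := by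
  constructor
  · intro h
    exact ⟨by simpa [diagForm] using congrFun (congrFun h 0) 0,
      by simpa [diagForm] using congrFun (congrFun h 2) 2⟩
  · rintro ⟨rfl, rfl⟩
    exact diagForm_one

theorem swapForm_mul_diagForm (e ν l μ : ℂ) :
    swapForm e ν * diagForm l μ = !![0, e * l⁻¹, 0; l, 0, 0; 0, 0, ν * μ] := by
  ext i j
  fin_cases i <;> fin_cases j <;>
    simp [swapForm, diagForm, Matrix.mul_apply, Fin.sum_univ_three]

theorem swapForm_sq (e ν : ℂ) : swapForm e ν ^ 2 = !![e, 0, 0; 0, e, 0; 0, 0, ν ^ 2] := by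
  ext i j
  fin_cases i <;> fin_cases j <;>
    simp [swapForm, pow_two, Matrix.mul_apply, Fin.sum_univ_three]

theorem diagForm_mul_swapForm_mul_diagForm {l μ : ℂ} (hl : l ≠ 0) (hμ : μ ^ 2 = 1) (e ν : ℂ) :
    diagForm l μ * swapForm e ν * diagForm l μ = swapForm e ν := by
  ext i j
  fin_cases i <;> fin_cases j <;>
    simp [swapForm, diagForm, Matrix.mul_apply, Fin.sum_univ_three, hl]
  · field_simp
  · linear_combination ν * hμ

/-- In some basis the pair `(A, B)` is given by `diagForm l μ` and `swapForm e ν`. -/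
def HasForm (A B : GL (Fin 3) ℂ) (l μ e ν : ℂ) : Prop :=
  ∃ C : GL (Fin 3) ℂ,
    (A : Matrix (Fin 3) (Fin 3) ℂ) * C = C * diagForm l μ ∧
    (B : Matrix (Fin 3) (Fin 3) ℂ) * C = C * swapForm e ν

variable {A B : GL (Fin 3) ℂ} {l μ e ν : ℂ}

theorem pow_mul_eq_mul_pow {n : ℕ} {A C : GL (Fin n) ℂ} {M : Matrix (Fin n) (Fin n) ℂ}
    (h : (A : Matrix (Fin n) (Fin n) ℂ) * C = C * M) (k : ℕ) :
    ((A ^ k : GL (Fin n) ℂ) : Matrix (Fin n) (Fin n) ℂ) * C = C * M ^ k := by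
  have : SemiconjBy (C : Matrix (Fin n) (Fin n) ℂ) M A := h.symm
  have := (this.pow_right k).eq
  rw [Units.val_pow_eq_pow_val, this]

theorem eq_of_val_mul_eq {n : ℕ} {A B C : GL (Fin n) ℂ}
    (h : (A : Matrix (Fin n) (Fin n) ℂ) * C = B * C) : A = B := by
  have : A * C = B * C := Units.ext h
  exact mul_right_cancel this

theorem HasForm.pow_left (h : HasForm A B l μ e ν) (k : ℕ) :
    HasForm (A ^ k) B (l ^ k) (μ ^ k) e ν := by
  obtain ⟨C, hA, hB⟩ := h
  exact ⟨C, by rw [pow_mul_eq_mul_pow hA, diagForm_pow], hB⟩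

theorem HasForm.pow_eq_one_iff (h : HasForm A B l μ e ν) (k : ℕ) :
    A ^ k = 1 ↔ l ^ k = 1 ∧ μ ^ k = 1 := by
  obtain ⟨C, hA, -⟩ := h
  have hk := pow_mul_eq_mul_pow hA k
  rw [diagForm_pow] at hk
  rw [← diagForm_eq_one_iff]
  constructor
  · intro h1
    rw [h1, Units.val_one, one_mul] at hk
    have := congrArg (fun M => ((C⁻¹ : GL (Fin 3) ℂ) : Matrix (Fin 3) (Fin 3) ℂ) * M) hk
    simpa [← mul_assoc] using this.symm
  · intro h1
    rw [h1, mul_one] at hk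
    exact eq_of_val_mul_eq (C := C) (by rw [hk, Units.val_one, one_mul])

theorem HasForm.conj (h : HasForm A B l μ e ν) {A' B' : GL (Fin 3) ℂ}
    (h' : HasForm A' B' l μ e ν) :
    ∃ D : GL (Fin 3) ℂ, D * A * D⁻¹ = A' ∧ D * B * D⁻¹ = B' := by
  obtain ⟨C, hA, hB⟩ := h
  obtain ⟨C', hA', hB'⟩ := h'
  have key : ∀ {X X' : GL (Fin 3) ℂ} {M : Matrix (Fin 3) (Fin 3) ℂ},
      (X : Matrix (Fin 3) (Fin 3) ℂ) * C = C * M → (X' : Matrix (Fin 3) (Fin 3) ℂ) * C' = C' * M →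
      (C' * C⁻¹) * X * (C' * C⁻¹)⁻¹ = X' := by
    intro X X' M h h'
    have h1 : M = ((C⁻¹ * X * C : GL (Fin 3) ℂ) : Matrix (Fin 3) (Fin 3) ℂ) := by
      rw [mul_assoc, Units.val_mul, Units.val_mul, h, ← mul_assoc]
      simp
    rw [h1, ← Units.val_mul, ← Units.val_mul] at h'
    have h2 := Units.ext h'
    rw [mul_inv_eq_iff_eq_mul]
    calc C' * C⁻¹ * X = C' * (C⁻¹ * X * C) * C⁻¹ := by group
      _ = X' * (C' * C⁻¹) := by rw [← h2]; group
  exact ⟨C' * C⁻¹, key hA hA', key hB hB'⟩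

/-- Since AB sends the first basis vector to l⁻¹ times the second, rescaling the second vector by
l⁻¹ restores the shape. This change of generators turns ν into μν. -/
theorem HasForm.mul_right (h : HasForm A B l μ e ν) (hl : l ≠ 0) :
    HasForm A (A * B) l μ e (μ * ν) := by
  obtain ⟨C, hA, hB⟩ := h
  let D : GL (Fin 3) ℂ := GeneralLinearGroup.mkOfDetNeZero !![1, 0, 0; 0, l⁻¹, 0; 0, 0, 1]
    (by simp [Matrix.det_fin_three, hl])
  have hD : (D : Matrix (Fin 3) (Fin 3) ℂ) = !![1, 0, 0; 0, l⁻¹, 0; 0, 0, 1] := rfl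
  refine ⟨C * D, ?_, ?_⟩
  · rw [Units.val_mul, ← mul_assoc, hA, mul_assoc, mul_assoc]
    congr 1
    rw [hD]
    ext i j
    fin_cases i <;> fin_cases j <;> simp [diagForm, Matrix.mul_apply, Fin.sum_univ_three]
  · rw [Units.val_mul, Units.val_mul, ← mul_assoc, mul_assoc (A : Matrix (Fin 3) (Fin 3) ℂ), hB,
      ← mul_assoc, hA, mul_assoc, mul_assoc, mul_assoc]
    congr 1
    rw [hD]
    ext i j
    fin_cases i <;> fin_cases j <;>
      simp [diagForm, swapForm, Matrix.mul_apply, Fin.sum_univ_three]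
    field_simp

/-- The columns of `D` are an eigenvector of the swap matrix for the eigenvalue i and its image
under the diagonal matrix: the roles of the two generators of Q₈ are exchanged. -/
theorem HasForm.swap (h : HasForm A B Complex.I 1 (-1) ν) : HasForm B A Complex.I ν (-1) 1 := by
  obtain ⟨C, hA, hB⟩ := h
  let D : GL (Fin 3) ℂ := GeneralLinearGroup.mkOfDetNeZero
    !![1, Complex.I, 0; -Complex.I, -1, 0; 0, 0, 1] (by simp [Matrix.det_fin_three]; norm_num)
  have hD : (D : Matrix (Fin 3) (Fin 3) ℂ) = !![1, Complex.I, 0; -Complex.I, -1, 0; 0, 0, 1] := rfl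
  refine ⟨C * D, ?_, ?_⟩
  · rw [Units.val_mul, ← mul_assoc, hB, mul_assoc, mul_assoc]
    congr 1
    rw [hD]
    ext i j
    fin_cases i <;> fin_cases j <;>
      simp [diagForm, swapForm, Matrix.mul_apply, Fin.sum_univ_three]
  · rw [Units.val_mul, ← mul_assoc, hA, mul_assoc, mul_assoc]
    congr 1
    rw [hD]
    ext i j
    fin_cases i <;> fin_cases j <;>
      simp [diagForm, swapForm, Matrix.mul_apply, Fin.sum_univ_three]

theorem HasForm.orderOf_eq (h : HasForm A B l μ e ν) {n : ℕ} (hl : IsPrimitiveRoot l n)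
    (hμ : μ ^ n = 1) : orderOf A = n := by
  refine Nat.dvd_antisymm (orderOf_dvd_of_pow_eq_one ((h.pow_eq_one_iff n).2 ⟨hl.pow_eq_one, hμ⟩))
    (hl.dvd_of_pow_eq_one _ ((h.pow_eq_one_iff _).1 (pow_orderOf_eq_one A)).1)

theorem HasForm.mul_mul_eq (h : HasForm A B l μ e ν) (hl : l ≠ 0) (hμ : μ ^ 2 = 1) :
    A * B * A = B := by
  obtain ⟨C, hA, hB⟩ := h
  refine eq_of_val_mul_eq (C := C) ?_
  rw [Units.val_mul, Units.val_mul, mul_assoc, hA, mul_assoc, ← mul_assoc _ _ (diagForm l μ), hB,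
    ← mul_assoc, ← mul_assoc, hA, mul_assoc, mul_assoc, ← mul_assoc (diagForm l μ),
    diagForm_mul_swapForm_mul_diagForm hl hμ]

theorem HasForm.sq_eq_pow (h : HasForm A B l μ e ν) {m : ℕ} (hl : l ^ m = e) (hl' : l ^ (2 * m) = 1)
    (hμ : ν ^ 2 = μ ^ m) : B ^ 2 = A ^ m := by
  obtain ⟨C, hA, hB⟩ := h
  refine eq_of_val_mul_eq (C := C) ?_
  rw [pow_mul_eq_mul_pow hA, pow_mul_eq_mul_pow hB, swapForm_sq, diagForm_pow, diagForm, hμ, hl]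
  have : e⁻¹ = e :=
    inv_eq_of_mul_eq_one_left (by rw [← hl, ← pow_add, ← two_mul, hl'])
  rw [this]

theorem HasForm.isSmall_closure (h : HasForm A B l μ e ν) {n m : ℕ} (hn : 0 < n)
    (hl : IsPrimitiveRoot l n) (hμ : μ ^ n = 1) (hμ2 : μ ^ 2 = 1) (hm : l ^ m = e)
    (hm' : l ^ (2 * m) = 1) (hν : ν ^ 2 = μ ^ m) (hsmall : e = -1 ∨ e = 1 ∧ μ = 1 ∧ ν = -1) :
    IsSmall (Subgroup.closure {A, B}) := by
  have hl0 : l ≠ 0 := hl.ne_zero hn.ne'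
  have hAn : A ^ n = 1 := (h.pow_eq_one_iff n).2 ⟨hl.pow_eq_one, hμ⟩
  have hfin : IsOfFinOrder A := isOfFinOrder_iff_pow_eq_one.2 ⟨n, hn, hAn⟩
  have hform := h
  obtain ⟨C, hA, hB⟩ := h
  intro X hX hpr
  rw [isPseudoReflection_iff_rank] at hpr
  obtain ⟨-, hrank⟩ := hpr
  obtain ⟨z, hz⟩ :=
    exists_zpow_of_mem_closure_pair (hform.mul_mul_eq hl0 hμ2) (hform.sq_eq_pow hm hm' hν) hX
  obtain ⟨k, hk⟩ : ∃ k : ℕ, A ^ k = A ^ z :=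
    hfin.mem_powers_iff_mem_zpowers.2 ⟨z, rfl⟩
  rw [← hk] at hz
  have hAk := pow_mul_eq_mul_pow hA k
  rcases hz with rfl | rfl
  · rw [rank_sub_one_eq_of_mul_eq_mul hAk, diagForm_pow] at hrank
    by_cases hlk : l ^ k = 1
    · obtain ⟨c, rfl⟩ := (hl.pow_eq_one_iff_dvd k).1 hlk
      rw [hlk, pow_mul, hμ, one_pow, diagForm_one, sub_self, Matrix.rank_zero] at hrank
      omega
    · have hlk' : (l ^ k)⁻¹ ≠ 1 := by rwa [ne_eq, inv_eq_one]
      have := Matrix.two_le_rank_of_minor_ne_zero (M := diagForm (l ^ k) (μ ^ k) - 1) 0 1 0 1 (by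
        simpa [diagForm, sub_eq_zero] using hlk)
      omega
  · have hBA : ((B * A ^ k : GL (Fin 3) ℂ) : Matrix (Fin 3) (Fin 3) ℂ) * C =
        C * (swapForm e ν * diagForm (l ^ k) (μ ^ k)) := by
      rw [Units.val_mul, mul_assoc, hAk, ← mul_assoc, hB, mul_assoc, diagForm_pow]
    rw [rank_sub_one_eq_of_mul_eq_mul hBA, swapForm_mul_diagForm] at hrank
    have hlk : l ^ k ≠ 0 := pow_ne_zero _ hl0
    rcases hsmall with rfl | ⟨rfl, rfl, rfl⟩
    -- With e = -1 the upper left minor equals 2.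
    · have := Matrix.two_le_rank_of_minor_ne_zero
        (M := !![0, -1 * (l ^ k)⁻¹, 0; l ^ k, 0, 0; 0, 0, ν * μ ^ k] - 1) 0 1 0 1 (by
          simp [hlk])
      omega
    -- With e = 1 that minor vanishes; the one on rows and columns 0 and 2 equals 2, since the third
    -- eigenvalue is -1.
    · have := Matrix.two_le_rank_of_minor_ne_zero
        (M := !![0, 1 * (l ^ k)⁻¹, 0; l ^ k, 0, 0; 0, 0, -1 * 1 ^ k] - 1) 0 2 0 2 (by
          simp)
      omega

/-- If l^k = 1, then A^k is diag(1, 1, μ^k) in the adapted basis, a pseudo-reflection unless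
trivial. -/
theorem HasForm.pow_eq_one_of_isSmall (h : HasForm A B l μ e ν) {H : Subgroup (GL (Fin 3) ℂ)}
    (hH : IsSmall H) (hA : A ∈ H) (hfin : IsOfFinOrder A) {k : ℕ} (hk : l ^ k = 1) : A ^ k = 1 := by
  by_contra hne
  have hμ : μ ^ k ≠ 1 := fun hμ => hne ((h.pow_eq_one_iff k).2 ⟨hk, hμ⟩)
  obtain ⟨C, hAC, -⟩ := h
  refine hH (A ^ k) (pow_mem hA k) ((isPseudoReflection_iff_rank _).2 ⟨hfin.pow, ?_⟩)
  rw [rank_sub_one_eq_of_mul_eq_mul (pow_mul_eq_mul_pow hAC k), diagForm_pow, hk]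
  refine le_antisymm ?_ ?_
  · have : diagForm 1 (μ ^ k) - 1 = vecMulVec ![0, 0, μ ^ k - 1] ![0, 0, 1] := by
      ext i j
      fin_cases i <;> fin_cases j <;> simp [diagForm, vecMulVec]
    rw [this]
    exact rank_vecMulVec_le _ _
  · refine Matrix.one_le_rank_of_ne_zero 2 2 ?_
    simpa [diagForm, sub_eq_zero] using hμ

/-- With e = 1 and ν = 1 the matrix B would merely exchange two basis vectors and fix the third, a
reflection. -/
theorem HasForm.eq_neg_one_of_isSmall (h : HasForm A B l μ 1 ν) {H : Subgroup (GL (Fin 3) ℂ)}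
    (hH : IsSmall H) (hB : B ∈ H) (hfin : IsOfFinOrder B) (hν : ν ^ 2 = 1) : ν = -1 := by
  refine (sq_eq_sq_iff_eq_or_eq_neg.1 (hν.trans (one_pow 2).symm)).resolve_left ?_
  rintro rfl
  obtain ⟨C, -, hBC⟩ := h
  refine hH B hB ((isPseudoReflection_iff_rank _).2 ⟨hfin, ?_⟩)
  rw [rank_sub_one_eq_of_mul_eq_mul hBC]
  refine le_antisymm ?_ ?_
  · have : swapForm 1 1 - 1 = vecMulVec ![-1, 1, 0] ![1, -1, 0] := by
      ext i j
      fin_cases i <;> fin_cases j <;> simp [swapForm, vecMulVec]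
    rw [this]
    exact rank_vecMulVec_le _ _
  · refine Matrix.one_le_rank_of_ne_zero 0 0 ?_
    simp [swapForm]

end NormalForm

/-! ### Existence of the normal form -/

section ExistsForm

/-- The minimal polynomial divides X^n - 1, so it is separable. If all its roots were ±1 it would
divide X² - 1, forcing A² = 1. -/
theorem exists_eigenvector_sq_ne_one {N : ℕ} {A : GL (Fin N) ℂ} {n : ℕ} (hn : 0 < n)
    (hA : A ^ n = 1) (hA2 : A ^ 2 ≠ 1) :
    ∃ (l : ℂ) (v : Fin N → ℂ), v ≠ 0 ∧ (A : Matrix (Fin N) (Fin N) ℂ) *ᵥ v = l • v ∧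
      l ^ n = 1 ∧ l ^ 2 ≠ 1 := by
  open Polynomial in
  set M : Matrix (Fin N) (Fin N) ℂ := A.val with hM
  have hMn : M ^ n = 1 := by rw [hM, ← Units.val_pow_eq_pow_val, hA, Units.val_one]
  have hdvd : minpoly ℂ M ∣ X ^ n - C 1 := minpoly.dvd _ _ (by simp [hMn])
  have hne : (X ^ n - C 1 : ℂ[X]) ≠ 0 := X_pow_sub_C_ne_zero hn 1
  have hsep : (minpoly ℂ M).Separable :=
    (separable_X_pow_sub_C (1 : ℂ) (by exact_mod_cast hn.ne') one_ne_zero).of_dvd hdvd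
  have hroot : ∀ {l : ℂ}, (minpoly ℂ M).IsRoot l → l ^ n = 1 := by
    intro l hl
    have := hl.dvd hdvd
    simpa [sub_eq_zero] using this
  obtain ⟨l, hl, hl2⟩ : ∃ l : ℂ, (minpoly ℂ M).IsRoot l ∧ l ^ 2 ≠ 1 := by
    by_contra! h
    apply hA2
    have h0 : minpoly ℂ M ≠ 0 := minpoly.ne_zero_of_finite ℂ M
    have hdvd2 : minpoly ℂ M ∣ X ^ 2 - C 1 := by
      refine (IsAlgClosed.splits _).dvd_of_roots_le_roots h0 ?_
      rw [Multiset.le_iff_subset (nodup_roots hsep)]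
      intro l hl
      rw [mem_roots h0] at hl
      rw [mem_roots (X_pow_sub_C_ne_zero two_pos 1)]
      simp [h l hl]
    have := (minpoly.dvd_iff).1 hdvd2
    simp only [map_sub, map_pow, aeval_X, map_one, sub_eq_zero] at this
    exact Units.ext (by rw [Units.val_pow_eq_pow_val, Units.val_one]; exact this)
  rw [← Matrix.minpoly_toLin', ← Module.End.hasEigenvalue_iff_isRoot] at hl
  obtain ⟨v, hv⟩ := hl.exists_hasEigenvector
  refine ⟨l, v, hv.2, ?_, ?_, hl2⟩
  · simpa using hv.apply_eq_smul
  · rw [Module.End.hasEigenvalue_iff_isRoot, Matrix.minpoly_toLin'] at hl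
    exact hroot hl

theorem exists_basis_matrix {v : Fin 3 → Fin 3 → ℂ} (hv : LinearIndependent ℂ v) :
    ∃ C : GL (Fin 3) ℂ, ∀ j, (C : Matrix (Fin 3) (Fin 3) ℂ).col j = v j := by
  have hu : IsUnit (Matrix.of v)ᵀ := by
    rw [Matrix.isUnit_transpose]
    exact Matrix.linearIndependent_rows_iff_isUnit.1 hv
  exact ⟨hu.unit, fun _ => rfl⟩

theorem mul_eq_of_mulVec_col {A C : GL (Fin 3) ℂ} {M : Matrix (Fin 3) (Fin 3) ℂ}
    (h : ∀ j, (A : Matrix (Fin 3) (Fin 3) ℂ) *ᵥ (C : Matrix (Fin 3) (Fin 3) ℂ).col j =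
      M 0 j • (C : Matrix (Fin 3) (Fin 3) ℂ).col 0 + M 1 j • (C : Matrix (Fin 3) (Fin 3) ℂ).col 1 +
        M 2 j • (C : Matrix (Fin 3) (Fin 3) ℂ).col 2) :
    (A : Matrix (Fin 3) (Fin 3) ℂ) * C = C * M := by
  ext i j
  have := congrFun (h j) i
  simp only [Matrix.mulVec, dotProduct, Matrix.col_apply, Pi.add_apply, Pi.smul_apply,
    smul_eq_mul] at this
  rw [Matrix.mul_apply, this, Matrix.mul_apply, Fin.sum_univ_three]
  ring

theorem exists_det_scalar_sub (M : Matrix (Fin 3) (Fin 3) ℂ) :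
    ∃ t c : ℂ, ∀ x : ℂ, (x • (1 : Matrix (Fin 3) (Fin 3) ℂ) - M).det =
      x ^ 3 - t * x ^ 2 + c * x - M.det := by
  refine ⟨M 0 0 + M 1 1 + M 2 2, M 0 0 * M 1 1 - M 0 1 * M 1 0 + M 0 0 * M 2 2 - M 0 2 * M 2 0 +
    M 1 1 * M 2 2 - M 1 2 * M 2 1, fun x => ?_⟩
  simp [Matrix.det_fin_three]
  ring

theorem exists_eigenvector_iff (M : Matrix (Fin 3) (Fin 3) ℂ) (x : ℂ) :
    (∃ v : Fin 3 → ℂ, v ≠ 0 ∧ M *ᵥ v = x • v) ↔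
      (x • (1 : Matrix (Fin 3) (Fin 3) ℂ) - M).det = 0 := by
  rw [← Matrix.exists_mulVec_eq_zero_iff]
  refine exists_congr fun v => and_congr_right fun _ => ?_
  rw [Matrix.sub_mulVec, Matrix.smul_mulVec, Matrix.one_mulVec, sub_eq_zero, eq_comm]

/-- The product of the three eigenvalues l, l⁻¹ and the last one is the determinant. To avoid
multiplicities, the relations p(l) = 0 and p(l⁻¹) = 0 for the characteristic polynomial p are
combined directly, for determinant 1 and -1 separately. -/
theorem exists_eigenvector_det {M : Matrix (Fin 3) (Fin 3) ℂ} (hdet : M.det ^ 2 = 1) {l : ℂ}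
    (hl0 : l ≠ 0) (hl2 : l ^ 2 ≠ 1) (h : ∃ v : Fin 3 → ℂ, v ≠ 0 ∧ M *ᵥ v = l • v)
    (h' : ∃ v : Fin 3 → ℂ, v ≠ 0 ∧ M *ᵥ v = l⁻¹ • v) :
    ∃ v : Fin 3 → ℂ, v ≠ 0 ∧ M *ᵥ v = M.det • v := by
  rw [exists_eigenvector_iff] at *
  obtain ⟨t, c, hp⟩ := exists_det_scalar_sub M
  rw [hp] at *
  have h1 : l - 1 ≠ 0 := fun h1 => hl2 (by linear_combination (l + 1) * h1)
  have h2 : l + 1 ≠ 0 := fun h1 => hl2 (by linear_combination (l - 1) * h1)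
  have h'' : 1 - t * l + c * l ^ 2 - M.det * l ^ 3 = 0 := by
    field_simp at h'
    linear_combination h'
  clear hp
  generalize M.det = d at *
  rcases sq_eq_sq_iff_eq_or_eq_neg.1 (hdet.trans (one_pow 2).symm) with rfl | rfl
  · have : l * (l + 1) * (c - t) = 0 := by linear_combination h + h''
    have := (mul_eq_zero.1 this).resolve_left (mul_ne_zero hl0 h2)
    linear_combination this
  · have : l * (l - 1) * (c + t) = 0 := by linear_combination h'' - h
    have := (mul_eq_zero.1 this).resolve_left (mul_ne_zero hl0 h1)
    linear_combination -this

/-- The relation `A * B * A = B` makes B carry the x-eigenspace of A to the x⁻¹-eigenspace and gives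
det(A)² = 1. The basis is v, Bv, w, with w an eigenvector for det A. -/
theorem exists_hasForm {A B : GL (Fin 3) ℂ} {n m : ℕ} (hn : 0 < n) (hA : A ^ n = 1)
    (hA2 : A ^ 2 ≠ 1) (hAB : A * B * A = B) (hB : B ^ 2 = A ^ m) :
    ∃ l μ ν : ℂ, HasForm A B l μ (l ^ m) ν ∧ l ^ n = 1 ∧ μ ^ 2 = 1 ∧ ν ^ 2 = μ ^ m := by
  obtain ⟨l, v, hv0, hv, hln, hl2⟩ := exists_eigenvector_sq_ne_one hn hA hA2
  have hl0 : l ≠ 0 := by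
    rintro rfl
    simp [hn.ne'] at hln
  set M : Matrix (Fin 3) (Fin 3) ℂ := A.val with hM
  set N : Matrix (Fin 3) (Fin 3) ℂ := B.val with hN
  have hMNM : M * N * M = N := by
    rw [hM, hN, ← Units.val_mul, ← Units.val_mul, hAB]
  have hNN : N * N = M ^ m := by
    rw [hM, hN, ← Units.val_mul, ← pow_two, hB, Units.val_pow_eq_pow_val]
  have hNdet : N.det ≠ 0 := ((Matrix.isUnit_iff_isUnit_det _).1 B.isUnit).ne_zero
  have hNinj : ∀ {x : Fin 3 → ℂ}, x ≠ 0 → N *ᵥ x ≠ 0 := fun {x} hx h0 =>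
    hNdet (Matrix.exists_mulVec_eq_zero_iff.1 ⟨x, hx, h0⟩)
  have hdet : M.det ^ 2 = 1 := by
    have := congrArg Matrix.det hMNM
    rw [det_mul, det_mul] at this
    refine mul_right_cancel₀ hNdet ?_
    linear_combination this
  have hinv : ∀ {x : ℂ} {w : Fin 3 → ℂ}, x ≠ 0 → M *ᵥ w = x • w →
      M *ᵥ (N *ᵥ w) = x⁻¹ • (N *ᵥ w) := by
    intro x w hx hw
    have h1 : N *ᵥ w = x • (M *ᵥ (N *ᵥ w)) := by
      rw [← Matrix.mulVec_smul, ← Matrix.mulVec_smul, ← hw, Matrix.mulVec_mulVec,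
        Matrix.mulVec_mulVec, hMNM]
    nth_rewrite 2 [h1]
    rw [inv_smul_smul₀ hx]
  have hpow : ∀ {x : ℂ} {w : Fin 3 → ℂ}, M *ᵥ w = x • w → ∀ k : ℕ, M ^ k *ᵥ w = x ^ k • w := by
    intro x w hw k
    induction k with
    | zero => simp
    | succ k ih => rw [pow_succ, ← Matrix.mulVec_mulVec, hw, Matrix.mulVec_smul, ih, smul_smul,
        pow_succ, mul_comm]
  obtain ⟨w, hw0, hw⟩ := exists_eigenvector_det hdet hl0 hl2 ⟨v, hv0, hv⟩
    ⟨N *ᵥ v, hNinj hv0, hinv hl0 hv⟩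
  have hd0 : M.det ≠ 0 := by
    intro h
    rw [h] at hdet
    norm_num at hdet
  have hdinv : M.det⁻¹ = M.det := inv_eq_of_mul_eq_one_left (by rw [← pow_two, hdet])
  have hll : l ≠ l⁻¹ := by
    intro h
    apply hl2
    rw [pow_two]
    nth_rewrite 2 [h]
    exact mul_inv_cancel₀ hl0
  have hld : l ≠ M.det := by
    rintro h
    rw [h] at hl2
    exact hl2 hdet
  have hld' : l⁻¹ ≠ M.det := by
    intro h
    rw [← hdinv] at h
    exact hld (inv_injective h)
  have hind : LinearIndependent ℂ ![v, N *ᵥ v, w] := by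
    refine Module.End.eigenvectors_linearIndependent' (Matrix.toLin' M) ![l, l⁻¹, M.det] ?_ _ ?_
    · intro i j
      fin_cases i <;> fin_cases j <;> simp [hll, hld, hld', hll.symm, hld.symm, hld'.symm]
    · intro i
      rw [Module.End.hasEigenvector_iff, Module.End.mem_eigenspace_iff, Matrix.toLin'_apply]
      fin_cases i
      · exact ⟨hv, hv0⟩
      · exact ⟨hinv hl0 hv, hNinj hv0⟩
      · exact ⟨hw, hw0⟩
  obtain ⟨C, hC⟩ := exists_basis_matrix hind
  have hC0 : (C : Matrix (Fin 3) (Fin 3) ℂ).col 0 = v := hC 0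
  have hC1 : (C : Matrix (Fin 3) (Fin 3) ℂ).col 1 = N *ᵥ v := hC 1
  have hC2 : (C : Matrix (Fin 3) (Fin 3) ℂ).col 2 = w := hC 2
  have hAC : M * C = C * diagForm l M.det := by
    refine mul_eq_of_mulVec_col fun j => ?_
    fin_cases j
    · simpa [hC0, hC1, hC2, diagForm] using hv
    · simpa [hC0, hC1, hC2, diagForm] using hinv hl0 hv
    · simpa [hC0, hC1, hC2, diagForm] using hw
  -- Bw has eigenvalue (det A)⁻¹ = det A, which differs from l and l⁻¹, so its first two coordinates
  -- in the eigenbasis vanish.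
  obtain ⟨ν, hν⟩ : ∃ ν : ℂ, N *ᵥ w = ν • w := by
    have hNw := hinv hd0 hw
    rw [hdinv] at hNw
    set y := ((C⁻¹ : GL (Fin 3) ℂ) : Matrix (Fin 3) (Fin 3) ℂ) *ᵥ (N *ᵥ w) with hy
    have hCy : (C : Matrix (Fin 3) (Fin 3) ℂ) *ᵥ y = N *ᵥ w := by
      rw [hy, Matrix.mulVec_mulVec, ← Units.val_mul, mul_inv_cancel]
      simp
    have hyd : diagForm l M.det *ᵥ y = M.det • y := by
      have h1 : (C : Matrix (Fin 3) (Fin 3) ℂ) *ᵥ (diagForm l M.det *ᵥ y) =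
          (C : Matrix (Fin 3) (Fin 3) ℂ) *ᵥ (M.det • y) := by
        rw [Matrix.mulVec_mulVec, ← hAC, ← Matrix.mulVec_mulVec, hCy, hNw, Matrix.mulVec_smul, hCy]
      exact Matrix.mulVec_injective_of_isUnit C.isUnit h1
    have hy0 : y 0 = 0 := by
      have := congrFun hyd 0
      simp [diagForm, Matrix.mulVec, dotProduct, Fin.sum_univ_three] at this
      exact this.resolve_left hld
    have hy1 : y 1 = 0 := by
      have := congrFun hyd 1
      simp [diagForm, Matrix.mulVec, dotProduct, Fin.sum_univ_three] at this
      exact this.resolve_left hld'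
    refine ⟨y 2, ?_⟩
    rw [← hCy, ← hC2]
    ext i
    simp [Matrix.mulVec, dotProduct, Fin.sum_univ_three, hy0, hy1, mul_comm]
  refine ⟨l, M.det, ν, ⟨C, hAC, mul_eq_of_mulVec_col fun j => ?_⟩, hln, hdet, ?_⟩
  · fin_cases j
    · simp [hC0, hC1, hC2, swapForm]
      rfl
    · have : N *ᵥ (N *ᵥ v) = l ^ m • v := by rw [Matrix.mulVec_mulVec, hNN, hpow hv]
      simpa [hC0, hC1, hC2, swapForm] using this
    · simpa [hC0, hC1, hC2, swapForm] using hν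
  · have h1 : N *ᵥ (N *ᵥ w) = M.det ^ m • w := by rw [Matrix.mulVec_mulVec, hNN, hpow hw]
    rw [hν, Matrix.mulVec_smul, hν, smul_smul] at h1
    rw [pow_two]
    exact smul_left_injective ℂ hw0 h1

/-- A pair of generators of a small dihedral or dicyclic group has a normal form with prescribed
primitive root of unity. -/
theorem exists_hasForm_of_isSmall {A B : GL (Fin 3) ℂ} {n m : ℕ} (hn : 3 ≤ n) (hA : orderOf A = n)
    (hAB : A * B * A = B) (hB : B ^ 2 = A ^ m) (hm : m = 0 ∨ n = 2 * m)
    {H : Subgroup (GL (Fin 3) ℂ)} (hH : IsSmall H) (hAH : A ∈ H) {l : ℂ}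
    (hl : IsPrimitiveRoot l n) :
    ∃ A' ∈ H, ∃ μ ν : ℂ, HasForm A' B l μ (l ^ m) ν ∧ μ ^ 2 = 1 ∧ μ ^ n = 1 ∧ ν ^ 2 = μ ^ m := by
  have hAn : A ^ n = 1 := hA ▸ pow_orderOf_eq_one A
  have hA2 : A ^ 2 ≠ 1 := fun h => by
    have := Nat.le_of_dvd two_pos (orderOf_dvd_of_pow_eq_one h)
    omega
  obtain ⟨k, μ, ν, hform, hkn, hμ, hν⟩ := exists_hasForm (by omega) hAn hA2 hAB hB
  have hfin : IsOfFinOrder A := isOfFinOrder_iff_pow_eq_one.2 ⟨n, by omega, hAn⟩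
  have hk : IsPrimitiveRoot k n := by
    refine ⟨hkn, fun j hj => ?_⟩
    rw [← hA]
    exact orderOf_dvd_of_pow_eq_one (hform.pow_eq_one_of_isSmall hH hAH hfin hj)
  have hμn : μ ^ n = 1 := ((hform.pow_eq_one_iff n).1 hAn).2
  have := NeZero.mk (n := n) (by omega)
  obtain ⟨j, -, hj, rfl⟩ := (hk.isPrimitiveRoot_iff).1 hl
  -- Here μ = ±1. For n even, j is odd, being coprime to n; for n odd, μ^n = 1 forces μ = 1.
  have hμj : μ ^ j = μ := by
    rcases Nat.even_or_odd n with he | ho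
    · have : Odd j := Nat.not_even_iff_odd.1 fun h => by
        have := Nat.dvd_gcd h.two_dvd he.two_dvd
        rw [hj.gcd_eq_one] at this
        omega
      obtain ⟨c, rfl⟩ := this
      rw [pow_succ, pow_mul, hμ, one_pow, one_mul]
    · obtain ⟨c, rfl⟩ := ho
      rw [pow_succ, pow_mul, hμ, one_pow, one_mul] at hμn
      rw [hμn, one_pow]
  -- Either m = 0, or the m-th power of any primitive 2m-th root of unity is -1.
  have hkm : (k ^ j) ^ m = k ^ m := by
    rcases hm with rfl | rfl
    · simp
    · have h0 : 0 < m := by omega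
      have h2 : ∀ {x : ℂ}, IsPrimitiveRoot x (2 * m) → x ^ m = -1 := by
        intro x hx
        have := (hx.pow (by omega) (mul_comm 2 m) : IsPrimitiveRoot (x ^ m) 2)
        exact this.eq_neg_one_of_two_right
      rw [h2 hl, h2 hk]
  refine ⟨A ^ j, pow_mem hAH j, μ, ν, ?_, hμ, hμn, hν⟩
  have := hform.pow_left j
  rwa [hμj, ← hkm] at this

end ExistsForm

/-! ### The alternating group of degree four -/

section Tetrahedral

theorem conjugateInGL_closure_pair {n : ℕ} {A B A' B' D : GL (Fin n) ℂ} (hA : D * A * D⁻¹ = A')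
    (hB : D * B * D⁻¹ = B') :
    ConjugateInGL (Subgroup.closure {A, B}) (Subgroup.closure {A', B'}) := by
  refine ⟨D, ?_⟩
  rw [MonoidHom.map_closure, Set.image_pair]
  simp [← hA, ← hB]

theorem ConjugateInGL.symm {n : ℕ} {H K : Subgroup (GL (Fin n) ℂ)} (h : ConjugateInGL H K) :
    ConjugateInGL K H := by
  obtain ⟨C, rfl⟩ := h
  refine ⟨C⁻¹, ?_⟩
  rw [Subgroup.map_map]
  convert Subgroup.map_id H
  ext x : 1
  simp [mul_assoc]

/-- The matrix of a permutation of degree four in the basis `e₀ - e₃`, `e₁ - e₃`,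
`e₂ - e₃` of the vectors with coordinate sum zero. -/
def deletedPermMatrix (σ : Equiv.Perm (Fin 4)) : Matrix (Fin 3) (Fin 3) ℤ :=
  fun i j => (if σ j.castSucc = i.castSucc then 1 else 0) - if σ 3 = i.castSucc then 1 else 0

theorem deletedPermMatrix_mul (σ τ : alternatingGroup (Fin 4)) :
    deletedPermMatrix (σ * τ : alternatingGroup (Fin 4)) =
      deletedPermMatrix σ * deletedPermMatrix τ := by
  revert σ τ
  decide +kernel

/-- The three-dimensional representation of the alternating group of degree four. -/
noncomputable def deletedPermRep : alternatingGroup (Fin 4) →* GL (Fin 3) ℂ :=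
  ((Int.castRingHom ℂ).mapMatrix.toMonoidHom.comp
    ({ toFun := fun σ => deletedPermMatrix σ
       map_one' := by decide
       map_mul' := deletedPermMatrix_mul } :
      alternatingGroup (Fin 4) →* Matrix (Fin 3) (Fin 3) ℤ)).toHomUnits

theorem deletedPermRep_val (σ : alternatingGroup (Fin 4)) :
    (deletedPermRep σ : Matrix (Fin 3) (Fin 3) ℂ) =
      (Int.castRingHom ℂ).mapMatrix (deletedPermMatrix σ) := rfl

/-- Integral matrices make smallness of this representation a finite decidable check. -/
theorem deletedPermMatrix_eq_one_or_minor_ne_zero (σ : alternatingGroup (Fin 4)) : σ = 1 ∨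
    ∃ i i' j j', (deletedPermMatrix σ - 1) i j * (deletedPermMatrix σ - 1) i' j' -
      (deletedPermMatrix σ - 1) i j' * (deletedPermMatrix σ - 1) i' j ≠ 0 := by
  revert σ
  decide +kernel

theorem deletedPermRep_injective : Function.Injective deletedPermRep := by
  refine (injective_iff_map_eq_one _).2 fun σ hσ => ?_
  have h1 := deletedPermRep_val σ
  rw [hσ, Units.val_one, ← map_one (Int.castRingHom ℂ).mapMatrix] at h1
  have h2 : deletedPermMatrix σ = 1 :=
    (Matrix.map_injective (RingHom.injective_int (Int.castRingHom ℂ)) h1).symm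
  have : ∀ σ : alternatingGroup (Fin 4), deletedPermMatrix σ = 1 → σ = 1 := by decide +kernel
  exact this σ h2

theorem isSmall_range_deletedPermRep : IsSmall deletedPermRep.range := by
  rintro _ ⟨σ, rfl⟩ hpr
  rw [isPseudoReflection_iff_rank, deletedPermRep_val,
    ← map_one (Int.castRingHom ℂ).mapMatrix, ← map_sub] at hpr
  obtain ⟨-, hrank⟩ := hpr
  rcases deletedPermMatrix_eq_one_or_minor_ne_zero σ with rfl | ⟨i, i', j, j', h⟩
  · have : deletedPermMatrix (1 : alternatingGroup (Fin 4)) = 1 := by decide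
    rw [this, sub_self, map_zero, Matrix.rank_zero] at hrank
    omega
  · have := Matrix.two_le_rank_of_minor_ne_zero
      (M := (Int.castRingHom ℂ).mapMatrix (deletedPermMatrix σ - 1)) i i' j j' (by
        simp only [RingHom.mapMatrix_apply, Matrix.map_apply]
        rw [← map_mul, ← map_mul, ← map_sub]
        simpa only [eq_intCast, ne_eq, Int.cast_eq_zero] using h)
    omega

/-- Here T, S, R are the involutions of the Klein group and c permutes them cyclically. A
simultaneous eigenvector x with signs (1, -1, -1) has translates under c with the three cyclically
shifted sign patterns, hence independent. -/
theorem exists_basis_of_tetrahedral_relations {c T S R : Matrix (Fin 3) (Fin 3) ℂ} (hT1 : T ≠ 1)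
    (hTT : T * T = 1) (hSS : S * S = 1) (hTS : T * S = R) (hST : S * T = R) (hTc : T * c = c * R)
    (hSc : S * c = c * T) (hRc : R * c = c * S) (hc : c * c * c = 1) :
    ∃ x : Fin 3 → ℂ, T *ᵥ x = x ∧ T *ᵥ (c *ᵥ x) = -(c *ᵥ x) ∧
      T *ᵥ (c *ᵥ (c *ᵥ x)) = -(c *ᵥ (c *ᵥ x)) ∧ c *ᵥ (c *ᵥ (c *ᵥ x)) = x ∧
      LinearIndependent ℂ ![c *ᵥ x, c *ᵥ (c *ᵥ x), x] := by
  have hc0 : ∀ {y : Fin 3 → ℂ}, y ≠ 0 → c *ᵥ y ≠ 0 := by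
    intro y hy h
    apply hy
    rw [← Matrix.one_mulVec y, ← hc, ← Matrix.mulVec_mulVec, h, Matrix.mulVec_zero]
  have rot : ∀ {X Y : Matrix (Fin 3) (Fin 3) ℂ} {y : Fin 3 → ℂ} {p : ℂ}, X * c = c * Y →
      Y *ᵥ y = p • y → X *ᵥ (c *ᵥ y) = p • (c *ᵥ y) := by
    intro X Y y p h hy
    rw [Matrix.mulVec_mulVec, h, ← Matrix.mulVec_mulVec, hy, Matrix.mulVec_smul]
  obtain ⟨x, hx0, hTx, hSx, hRx⟩ : ∃ x : Fin 3 → ℂ, x ≠ 0 ∧ T *ᵥ x = (1 : ℂ) • x ∧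
      S *ᵥ x = (-1 : ℂ) • x ∧ R *ᵥ x = (-1 : ℂ) • x := by
    obtain ⟨v, hv0, hv⟩ : ∃ v : Fin 3 → ℂ, v ≠ 0 ∧ T *ᵥ v = -v := by
      obtain ⟨y, hy⟩ : ∃ y : Fin 3 → ℂ, T *ᵥ y ≠ y := by
        by_contra! h
        exact hT1 (Matrix.ext_of_mulVec_single fun i => by rw [h, Matrix.one_mulVec])
      refine ⟨T *ᵥ y - y, sub_ne_zero.2 hy, ?_⟩
      rw [Matrix.mulVec_sub, Matrix.mulVec_mulVec, hTT, Matrix.one_mulVec, neg_sub]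
    have hTSv : T *ᵥ (S *ᵥ v) = -(S *ᵥ v) := by
      rw [Matrix.mulVec_mulVec, hTS, ← hST, ← Matrix.mulVec_mulVec, hv, Matrix.mulVec_neg]
    have hSSv : S *ᵥ (S *ᵥ v) = v := by rw [Matrix.mulVec_mulVec, hSS, Matrix.one_mulVec]
    have hR : ∀ y : Fin 3 → ℂ, R *ᵥ y = T *ᵥ (S *ᵥ y) := fun y => by
      rw [Matrix.mulVec_mulVec, hTS]
    -- Either v has signs (-1, -1, 1), or v + Sv is nonzero with signs (-1, 1, -1). One or two
    -- applications of c bring the pattern to (1, -1, -1).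
    by_cases hw : v + S *ᵥ v = 0
    · have hSv : S *ᵥ v = -v := by rw [eq_neg_iff_add_eq_zero, add_comm, hw]
      refine ⟨c *ᵥ v, hc0 hv0, rot hTc ?_, rot hSc ?_, rot hRc ?_⟩
      · rw [hR, hSv, Matrix.mulVec_neg, hv, neg_neg, one_smul]
      · rw [hv, neg_smul, one_smul]
      · rw [hSv, neg_smul, one_smul]
    · refine ⟨c *ᵥ (c *ᵥ (v + S *ᵥ v)), hc0 (hc0 hw), rot hTc (rot hRc ?_), rot hSc (rot hTc ?_),
        rot hRc (rot hSc ?_)⟩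
      · rw [Matrix.mulVec_add, hSSv, one_smul, add_comm]
      · rw [hR, Matrix.mulVec_add, hSSv, Matrix.mulVec_add, hTSv, hv, neg_smul, one_smul, neg_add,
          add_comm]
      · rw [Matrix.mulVec_add, hTSv, hv, neg_smul, one_smul, neg_add]
  have hT1 := rot hTc hRx
  have hS1 := rot hSc hTx
  have hT2 := rot hTc (rot hRc hSx)
  have hS2 := rot hSc (rot hTc hRx)
  refine ⟨x, by rw [hTx, one_smul], by rw [hT1, neg_smul, one_smul],
    by rw [hT2, neg_smul, one_smul], ?_, ?_⟩
  · rw [Matrix.mulVec_mulVec, Matrix.mulVec_mulVec, hc, Matrix.one_mulVec]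
  -- The combination T + 2S separates the sign patterns: its eigenvalues on cx, c²x, x are 1, -3,
  -- -1.
  · refine Module.End.eigenvectors_linearIndependent' (Matrix.toLin' (T + (2 : ℂ) • S))
      ![1, -3, -1] ?_ _ ?_
    · intro i j
      fin_cases i <;> fin_cases j <;> simp <;> norm_num
    · intro i
      rw [Module.End.hasEigenvector_iff, Module.End.mem_eigenspace_iff, Matrix.toLin'_apply,
        Matrix.add_mulVec, Matrix.smul_mulVec]
      fin_cases i
      · refine ⟨?_, hc0 hx0⟩
        change T *ᵥ (c *ᵥ x) + (2 : ℂ) • (S *ᵥ (c *ᵥ x)) = (1 : ℂ) • (c *ᵥ x)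
        rw [hT1, hS1, smul_smul, ← add_smul]
        norm_num
      · refine ⟨?_, hc0 (hc0 hx0)⟩
        change T *ᵥ (c *ᵥ (c *ᵥ x)) + (2 : ℂ) • (S *ᵥ (c *ᵥ (c *ᵥ x))) =
          (-3 : ℂ) • (c *ᵥ (c *ᵥ x))
        rw [hT2, hS2, smul_smul, ← add_smul]
        norm_num
      · refine ⟨?_, hx0⟩
        change T *ᵥ x + (2 : ℂ) • (S *ᵥ x) = (-1 : ℂ) • x
        rw [hTx, hSx, smul_smul, ← add_smul]
        norm_num

variable {ζ₃ ζ₅ : ℂ} (h₃ : IsPrimitiveRoot ζ₃ 3) (h₅ : IsPrimitiveRoot ζ₅ 5)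

/-- A faithful three-dimensional representation of the alternating group of degree four is unique
up to conjugacy. -/
theorem conjugateInGL_range_of_alternatingGroup {f : alternatingGroup (Fin 4) →* GL (Fin 3) ℂ}
    (hf : Function.Injective f) : ConjugateInGL f.range (Entry.a4.image h₃ h₅) := by
  let c : alternatingGroup (Fin 4) :=
    ⟨Equiv.swap 0 1 * Equiv.swap 1 2, Equiv.Perm.mem_alternatingGroup.2 (by decide)⟩
  let t : alternatingGroup (Fin 4) :=
    ⟨Equiv.swap 0 1 * Equiv.swap 2 3, Equiv.Perm.mem_alternatingGroup.2 (by decide)⟩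
  let s := c * t * c⁻¹
  let r := c⁻¹ * t * c
  have hmap : ∀ {x y z w : alternatingGroup (Fin 4)}, x * y = z * w →
      (f x : Matrix (Fin 3) (Fin 3) ℂ) * f y = f z * f w := fun {x y z w} h => by
    rw [← Units.val_mul, ← Units.val_mul, ← map_mul, ← map_mul, h]
  have hone : (f 1 : Matrix (Fin 3) (Fin 3) ℂ) = 1 := by rw [map_one, Units.val_one]
  obtain ⟨x, hTx, hTcx, hTccx, hcccx, hind⟩ :=
    exists_basis_of_tetrahedral_relations (c := (f c).val) (T := (f t).val) (S := (f s).val)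
      (R := (f r).val)
      (fun h => by
        have h1 : f t = f 1 := Units.ext (h.trans hone.symm)
        exact absurd (hf h1) (by decide))
      (by rw [← mul_one 1, ← hone]; exact hmap (by decide))
      (by rw [← mul_one 1, ← hone]; exact hmap (by decide))
      (by rw [← mul_one (f r).val, ← hone]; exact hmap (by decide))
      (by rw [← mul_one (f r).val, ← hone]; exact hmap (by decide))
      (hmap (by decide)) (hmap (by decide)) (hmap (by decide))
      (by rw [← Units.val_mul, ← map_mul, ← mul_one 1, ← hone]; exact hmap (by decide))
  obtain ⟨D, hD⟩ := exists_basis_matrix hind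
  have hD0 : (D : Matrix (Fin 3) (Fin 3) ℂ).col 0 = (f c).val *ᵥ x := hD 0
  have hD1 : (D : Matrix (Fin 3) (Fin 3) ℂ).col 1 = (f c).val *ᵥ ((f c).val *ᵥ x) := hD 1
  have hD2 : (D : Matrix (Fin 3) (Fin 3) ℂ).col 2 = x := hD 2
  have hA : (f c).val * D.val = D.val * Entry.a4.matA ζ₃ ζ₅ := by
    refine mul_eq_of_mulVec_col fun j => ?_
    fin_cases j
    · simp [hD0, hD1, hD2, Entry.matA]
    · simpa [hD0, hD1, hD2, Entry.matA] using hcccx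
    · simp [hD0, hD1, hD2, Entry.matA]
  have hB : (f t).val * D.val = D.val * Entry.a4.matB := by
    refine mul_eq_of_mulVec_col fun j => ?_
    fin_cases j
    · simpa [hD0, hD1, hD2, Entry.matB] using hTcx
    · simpa [hD0, hD1, hD2, Entry.matB] using hTccx
    · simpa [hD0, hD1, hD2, Entry.matB] using hTx
  have hA' : f c * D = D * Entry.a4.genA h₃ h₅ := Units.ext hA
  have hB' : f t * D = D * Entry.a4.genB := Units.ext hB
  have hgen : f.range = Subgroup.closure {f c, f t} := by
    rw [MonoidHom.range_eq_map, ← Set.image_pair, ← MonoidHom.map_closure]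
    congr 1
    symm
    rw [Subgroup.eq_top_iff']
    intro g
    -- A₄ is the Klein group, generated by t and its conjugate, extended by the powers of c.
    have hword : ∀ g : alternatingGroup (Fin 4), ∃ i j : Fin 2, ∃ k : Fin 3,
        g = t ^ (i : ℕ) * (c * t * c⁻¹) ^ (j : ℕ) * c ^ (k : ℕ) := by decide +kernel
    obtain ⟨i, j, k, rfl⟩ := hword g
    have hc : c ∈ Subgroup.closure {c, t} := Subgroup.subset_closure (by simp)
    have ht : t ∈ Subgroup.closure {c, t} := Subgroup.subset_closure (by simp)
    exact mul_mem (mul_mem (pow_mem ht _)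
      (pow_mem (mul_mem (mul_mem hc ht) (inv_mem hc)) _)) (pow_mem hc _)
  rw [hgen]
  refine conjugateInGL_closure_pair (D := D⁻¹) ?_ ?_
  · rw [inv_inv, mul_assoc, hA', inv_mul_cancel_left]
  · rw [inv_inv, mul_assoc, hB', inv_mul_cancel_left]

end Tetrahedral

/-! ### Normal forms, smallness and abstract groups of the entries -/

namespace Entry

section Parameters

/-- The order of the rotation part of a dihedral or dicyclic entry. -/
def rotOrder : Entry → ℕ
  | s3 => 3
  | d8 | q8₁ | q8₂ => 4
  | d10 => 5
  | _ => 6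

/-- The exponent `m` in the relation `B ^ 2 = A ^ m` between the generators. -/
def sqExponent : Entry → ℕ
  | q8₁ | q8₂ => 2
  | bd3₁ | bd3₂ | bd3₃ => 3
  | _ => 0

/-- The first eigenvalue of the first generator. -/
noncomputable def rotEigenvalue (ζ₃ ζ₅ : ℂ) : Entry → ℂ
  | s3 => ζ₃
  | d8 | q8₁ | q8₂ => Complex.I
  | d10 => ζ₅
  | _ => -(ζ₃ ^ 2)

/-- The eigenvalue of the first generator on the common eigenvector. -/
def charA : Entry → ℂ
  | q8₂ | bd3₂ => -1
  | _ => 1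

/-- The sign of the two-dimensional part of the second generator. -/
def swapSign : Entry → ℂ
  | q8₁ | q8₂ | bd3₁ | bd3₂ | bd3₃ => -1
  | _ => 1

/-- The eigenvalue of the second generator on the common eigenvector. -/
noncomputable def charB : Entry → ℂ
  | q8₁ | q8₂ | bd3₁ => 1
  | bd3₂ => Complex.I
  | _ => -1

end Parameters

theorem isPrimitiveRoot_neg_sq {ζ₃ : ℂ} (h₃ : IsPrimitiveRoot ζ₃ 3) :
    IsPrimitiveRoot (-(ζ₃ ^ 2)) 6 := by
  have h1 : orderOf (ζ₃ ^ 2) = 3 := (h₃.pow_of_coprime 2 (by norm_num)).eq_orderOf.symm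
  have h2 : orderOf (-1 : ℂ) = 2 := (IsPrimitiveRoot.neg_one 0 (by norm_num)).eq_orderOf.symm
  have h3 := (Commute.all (-1 : ℂ) (ζ₃ ^ 2)).orderOf_mul_eq_mul_orderOf_of_coprime
    (by rw [h1, h2]; norm_num)
  rw [h1, h2, neg_one_mul] at h3
  rw [show 6 = 2 * 3 by norm_num, ← h3]
  exact IsPrimitiveRoot.orderOf _

theorem isPrimitiveRoot_I : IsPrimitiveRoot Complex.I 4 := by
  rw [IsPrimitiveRoot.iff_def]
  refine ⟨Complex.I_pow_four, fun l hl => ?_⟩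
  have h : orderOf Complex.I = 2 ^ (1 + 1) :=
    orderOf_eq_prime_pow (by rw [pow_one, Complex.I_sq]; norm_num) Complex.I_pow_four
  have := orderOf_dvd_of_pow_eq_one hl
  rwa [h] at this

variable {ζ₃ ζ₅ : ℂ} (h₃ : IsPrimitiveRoot ζ₃ 3) (h₅ : IsPrimitiveRoot ζ₅ 5)

include h₃ in
theorem one_add_add_sq : 1 + ζ₃ + ζ₃ ^ 2 = 0 := by
  have := h₃.geom_sum_eq_zero (by norm_num)
  simpa [Finset.sum_range_succ] using this

include h₃ h₅ in
theorem isPrimitiveRoot_rotEigenvalue (k : Entry) :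
    IsPrimitiveRoot (k.rotEigenvalue ζ₃ ζ₅) k.rotOrder := by
  cases k
  case s3 => exact h₃
  case d10 => exact h₅
  case d8 | q8₁ | q8₂ => exact isPrimitiveRoot_I
  all_goals exact isPrimitiveRoot_neg_sq h₃

theorem three_le_rotOrder (k : Entry) : 3 ≤ k.rotOrder := by
  cases k <;> simp [rotOrder]

theorem charA_pow_rotOrder (k : Entry) : k.charA ^ k.rotOrder = 1 := by
  cases k <;> norm_num [charA, rotOrder]

theorem charA_sq (k : Entry) : k.charA ^ 2 = 1 := by
  cases k <;> norm_num [charA]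

theorem charB_sq (k : Entry) : k.charB ^ 2 = k.charA ^ k.sqExponent := by
  cases k <;> norm_num [charA, charB, sqExponent]

include h₃ in
theorem rotEigenvalue_pow_sqExponent (k : Entry) :
    k.rotEigenvalue ζ₃ ζ₅ ^ k.sqExponent = k.swapSign := by
  have h : (-(ζ₃ ^ 2)) ^ 3 = -1 := by
    linear_combination (-(ζ₃ ^ 3) - 1) * h₃.pow_eq_one
  cases k <;> simp [rotEigenvalue, sqExponent, swapSign, h]

theorem swapSign_sq (k : Entry) : k.swapSign ^ 2 = 1 := by
  cases k <;> norm_num [swapSign]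

theorem swapSign_cases (k : Entry) :
    k.swapSign = -1 ∨ k.swapSign = 1 ∧ k.charA = 1 ∧ k.charB = -1 := by
  cases k <;> simp [swapSign, charA, charB]

theorem hasForm_of_matrix {A B : GL (Fin 3) ℂ} {l μ e ν : ℂ} (C : Matrix (Fin 3) (Fin 3) ℂ)
    (hC : C.det ≠ 0) (hA : A.val * C = C * diagForm l μ) (hB : B.val * C = C * swapForm e ν) :
    HasForm A B l μ e ν :=
  ⟨GeneralLinearGroup.mkOfDetNeZero C hC, hA, hB⟩

theorem genA_val (k : Entry) : (k.genA h₃ h₅).val = k.matA ζ₃ ζ₅ := rfl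

theorem genB_val (k : Entry) : k.genB.val = k.matB := rfl

theorem hasForm_gen {k : Entry} (hk : k ≠ a4) :
    HasForm (k.genA h₃ h₅) k.genB (k.rotEigenvalue ζ₃ ζ₅) k.charA k.swapSign k.charB := by
  have h1 := one_add_add_sq h₃
  have h2 := h₃.pow_eq_one
  have hinv : ζ₃⁻¹ = ζ₃ ^ 2 := inv_eq_of_mul_eq_one_left (by rw [← pow_succ, h2])
  have hinv2 : (ζ₃ ^ 2)⁻¹ = ζ₃ := inv_eq_of_mul_eq_one_left (by rw [← pow_succ', h2])
  have hinv5 : ζ₅⁻¹ = ζ₅ ^ 4 := inv_eq_of_mul_eq_one_left (by rw [← pow_succ, h₅.pow_eq_one])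
  cases k
  case a4 => exact absurd rfl hk
  case s3 =>
    -- In each of these base changes the columns are v, Bv and the third unit vector, where v is an
    -- eigenvector of the first generator for `rotEigenvalue`.
    refine hasForm_of_matrix !![1, ζ₃ ^ 2, 0; -ζ₃, -ζ₃, 0; 0, 0, 1] ?_ ?_ ?_
    · have : ζ₃ ≠ 1 := h₃.ne_one (by norm_num)
      simp [Matrix.det_fin_three]
      intro h
      apply this
      linear_combination h2 - h
    all_goals
      simp only [genA_val, genB_val]
      ext i j
      fin_cases i <;> fin_cases j <;>
        simp [matA, matB, rotEigenvalue, charA, swapSign, charB, diagForm, swapForm,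
          Matrix.mul_apply, Fin.sum_univ_three, hinv]
    · linear_combination (-ζ₃) * h2
    · linear_combination h1
    · linear_combination h1 + h2
    · linear_combination -h1
    · linear_combination -h1
  case d8 =>
    refine hasForm_of_matrix !![1, 1, 0; -Complex.I, Complex.I, 0; 0, 0, 1] ?_ ?_ ?_
    · simp [Matrix.det_fin_three]
    all_goals
      simp only [genA_val, genB_val]
      ext i j
      fin_cases i <;> fin_cases j <;>
        simp [matA, matB, rotEigenvalue, charA, swapSign, charB, diagForm, swapForm,
          Matrix.mul_apply, Fin.sum_univ_three]
  case q8₁ | q8₂ | d10 | d12 =>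
    refine hasForm_of_matrix 1 (by simp) ?_ ?_
    all_goals
      simp only [genA_val, genB_val, mul_one, one_mul]
      simp [matA, matB, rotEigenvalue, charA, swapSign, charB, diagForm, swapForm, hinv5, hinv2,
        inv_neg]
  all_goals
    refine hasForm_of_matrix !![1, 0, 0; 0, -Complex.I, 0; 0, 0, 1]
      (by simp [Matrix.det_fin_three]) ?_ ?_
    all_goals
      simp only [genA_val, genB_val]
      ext i j
      fin_cases i <;> fin_cases j <;>
        simp [matA, matB, rotEigenvalue, charA, swapSign, charB, diagForm, swapForm,
          Matrix.mul_apply, Fin.sum_univ_three, hinv2, inv_neg, mul_comm]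

theorem orderOf_genA {k : Entry} (hk : k ≠ a4) : orderOf (k.genA h₃ h₅) = k.rotOrder :=
  (hasForm_gen h₃ h₅ hk).orderOf_eq (isPrimitiveRoot_rotEigenvalue h₃ h₅ k) k.charA_pow_rotOrder

include h₃ h₅ in
theorem rotEigenvalue_ne_zero (k : Entry) : k.rotEigenvalue ζ₃ ζ₅ ≠ 0 :=
  (isPrimitiveRoot_rotEigenvalue h₃ h₅ k).ne_zero (by have := k.three_le_rotOrder; omega)

theorem genA_mul_genB_mul_genA {k : Entry} (hk : k ≠ a4) :
    k.genA h₃ h₅ * k.genB * k.genA h₃ h₅ = k.genB :=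
  (hasForm_gen h₃ h₅ hk).mul_mul_eq (rotEigenvalue_ne_zero h₃ h₅ k) k.charA_sq

include h₃ in
theorem rotEigenvalue_pow_two_mul (k : Entry) :
    k.rotEigenvalue ζ₃ ζ₅ ^ (2 * k.sqExponent) = 1 := by
  rw [mul_comm, pow_mul, rotEigenvalue_pow_sqExponent h₃, swapSign_sq]

theorem genB_sq {k : Entry} (hk : k ≠ a4) : k.genB ^ 2 = k.genA h₃ h₅ ^ k.sqExponent :=
  (hasForm_gen h₃ h₅ hk).sq_eq_pow (rotEigenvalue_pow_sqExponent h₃ k)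
    (rotEigenvalue_pow_two_mul h₃ k) k.charB_sq

/-- For `a4` smallness is transported from the deleted permutation representation, to which the
entry is conjugate by uniqueness. -/
theorem isSmall_image (k : Entry) : IsSmall (k.image h₃ h₅) := by
  by_cases hk : k = a4
  · subst hk
    exact isSmall_range_deletedPermRep.of_conjugate
      (conjugateInGL_range_of_alternatingGroup h₃ h₅ deletedPermRep_injective)
  · exact (hasForm_gen h₃ h₅ hk).isSmall_closure (by have := k.three_le_rotOrder; omega)
      (isPrimitiveRoot_rotEigenvalue h₃ h₅ k) k.charA_pow_rotOrder k.charA_sq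
      (rotEigenvalue_pow_sqExponent h₃ k) (rotEigenvalue_pow_two_mul h₃ k) k.charB_sq
      k.swapSign_cases

theorem nonempty_model_equiv_image (k : Entry) : Nonempty (k.Model ≃* k.image h₃ h₅) := by
  by_cases hk : k = a4
  · subst hk
    obtain ⟨e⟩ := (conjugateInGL_range_of_alternatingGroup h₃ h₅
      deletedPermRep_injective).nonempty_equiv
    exact ⟨(MonoidHom.ofInjective deletedPermRep_injective).trans e⟩
  have ho := orderOf_genA h₃ h₅ hk
  have hi := genA_mul_genB_mul_genA h₃ h₅ hk
  have hs := genB_sq h₃ h₅ hk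
  cases k
  case a4 => exact absurd rfl hk
  case s3 =>
    obtain ⟨e⟩ := nonempty_dihedralGroup_equiv_closure ho le_rfl hi (by rw [hs]; rfl)
    obtain ⟨e'⟩ := nonempty_dihedralGroup_three_equiv_perm
    exact ⟨e'.symm.trans e⟩
  case d8 | d10 | d12 =>
    exact nonempty_dihedralGroup_equiv_closure ho (by decide) hi (by rw [hs]; rfl)
  case q8₁ | q8₂ =>
    exact nonempty_quaternionGroup_equiv_closure (n := 2) ho (by decide) hi hs
  all_goals
    obtain ⟨e⟩ := nonempty_quaternionGroup_equiv_closure (n := 3) ho (by decide) hi hs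
    obtain ⟨e'⟩ := nonempty_quaternionGroup_equiv_bd3
    exact ⟨e'.symm.trans e⟩

/-! ### Invariants separating the entries -/

/-- The order of the group of an entry. -/
def order : Entry → ℕ
  | a4 => 12
  | k => 2 * k.rotOrder

theorem card_model (k : Entry) : Nat.card k.Model = k.order := by
  have hbd : Nat.card BD3 = 12 := by
    obtain ⟨e⟩ := nonempty_quaternionGroup_equiv_bd3
    rw [← Nat.card_congr e.toEquiv, Nat.card_eq_fintype_card, QuaternionGroup.card]
  cases k
  case s3 => exact (Nat.card_eq_fintype_card (α := Equiv.Perm (Fin 3))).trans (by decide)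
  case d8 => exact DihedralGroup.nat_card (n := 4)
  case d10 => exact DihedralGroup.nat_card (n := 5)
  case d12 => exact DihedralGroup.nat_card (n := 6)
  case q8₁ | q8₂ =>
    exact (Nat.card_eq_fintype_card (α := QuaternionGroup 2)).trans QuaternionGroup.card
  case a4 => exact (Nat.card_eq_fintype_card (α := alternatingGroup (Fin 4))).trans (by decide)
  all_goals exact hbd

theorem order_pos (k : Entry) : 0 < k.order := by
  cases k <;> decide

theorem order_le (k : Entry) : k.order ≤ 12 := by
  cases k <;> decide

theorem finite_model (k : Entry) : Finite k.Model :=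
  Nat.finite_of_card_ne_zero (by rw [card_model]; exact k.order_pos.ne')

theorem card_image (k : Entry) : Nat.card (k.image h₃ h₅) = k.order := by
  obtain ⟨e⟩ := nonempty_model_equiv_image h₃ h₅ k
  rw [← Nat.card_congr e.toEquiv, card_model]

include h₃ h₅ in
theorem exists_not_commute_model (k : Entry) : ∃ a b : k.Model, a * b ≠ b * a := by
  by_cases hk : k = a4
  · subst hk
    have : ∃ a b : alternatingGroup (Fin 4), a * b ≠ b * a := by decide +kernel
    exact this
  · obtain ⟨e⟩ := nonempty_model_equiv_image h₃ h₅ k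
    have h := not_commute_of_inverts (genA_mul_genB_mul_genA h₃ h₅ hk)
      (by rw [orderOf_genA h₃ h₅ hk]; exact k.three_le_rotOrder)
    let a : k.image h₃ h₅ := ⟨k.genA h₃ h₅, Subgroup.subset_closure (by simp)⟩
    let b : k.image h₃ h₅ := ⟨k.genB, Subgroup.subset_closure (by simp)⟩
    refine ⟨e.symm a, e.symm b, fun hab => h ?_⟩
    rw [← map_mul, ← map_mul] at hab
    exact congrArg Subtype.val (e.symm.injective hab)

/-- The number of elements with trivial square in the group of an entry. -/
def sqEqOneCount : Entry → ℕ
  | s3 | a4 => 4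
  | d8 | d10 => 6
  | d12 => 8
  | _ => 2

theorem _root_.MulEquiv.card_sq_eq_one {G H : Type*} [Group G] [Group H] (e : G ≃* H) :
    Nat.card {g : G // g ^ 2 = 1} = Nat.card {h : H // h ^ 2 = 1} :=
  Nat.card_congr (e.toEquiv.subtypeEquiv fun g => by
    rw [MulEquiv.toEquiv_eq_coe, MulEquiv.coe_toEquiv, ← map_pow, EmbeddingLike.map_eq_one_iff])

theorem card_sq_eq_one_model (k : Entry) :
    Nat.card {g : k.Model // g ^ 2 = 1} = k.sqEqOneCount := by
  have hbd : Nat.card {g : BD3 // g ^ 2 = 1} = 2 := by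
    obtain ⟨e⟩ := nonempty_quaternionGroup_equiv_bd3
    rw [← e.card_sq_eq_one, Nat.card_eq_fintype_card]
    decide +kernel
  cases k
  case s3 =>
    exact (Nat.card_eq_fintype_card (α := {g : Equiv.Perm (Fin 3) // g ^ 2 = 1})).trans
      (by decide +kernel)
  case d8 =>
    exact (Nat.card_eq_fintype_card (α := {g : DihedralGroup 4 // g ^ 2 = 1})).trans
      (by decide +kernel)
  case d10 =>
    exact (Nat.card_eq_fintype_card (α := {g : DihedralGroup 5 // g ^ 2 = 1})).trans
      (by decide +kernel)
  case d12 =>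
    exact (Nat.card_eq_fintype_card (α := {g : DihedralGroup 6 // g ^ 2 = 1})).trans
      (by decide +kernel)
  case q8₁ | q8₂ =>
    exact (Nat.card_eq_fintype_card (α := {g : QuaternionGroup 2 // g ^ 2 = 1})).trans
      (by decide +kernel)
  case a4 =>
    exact (Nat.card_eq_fintype_card (α := {g : alternatingGroup (Fin 4) // g ^ 2 = 1})).trans
      (by decide +kernel)
  all_goals exact hbd

theorem order_and_sqEqOneCount_eq_of_conjugate {k l : Entry}
    (h : ConjugateInGL (k.image h₃ h₅) (l.image h₃ h₅)) :
    k.order = l.order ∧ k.sqEqOneCount = l.sqEqOneCount := by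
  obtain ⟨e⟩ := h.nonempty_equiv
  obtain ⟨ek⟩ := nonempty_model_equiv_image h₃ h₅ k
  obtain ⟨el⟩ := nonempty_model_equiv_image h₃ h₅ l
  have e' := (ek.trans e).trans el.symm
  rw [← card_model, ← card_model, ← card_sq_eq_one_model, ← card_sq_eq_one_model]
  exact ⟨Nat.card_congr e'.toEquiv, e'.card_sq_eq_one⟩

/-- Whether all determinants in a group are N-th roots of unity is a conjugacy invariant that can be
tested on generators. -/
theorem det_pow_eq_one_of_conjugate {k l : Entry} {N : ℕ}
    (h : ConjugateInGL (k.image h₃ h₅) (l.image h₃ h₅))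
    (hA : (k.matA ζ₃ ζ₅).det ^ N = 1) (hB : k.matB.det ^ N = 1) :
    (l.matA ζ₃ ζ₅).det ^ N = 1 ∧ l.matB.det ^ N = 1 := by
  have hk : ∀ X ∈ k.image h₃ h₅, GeneralLinearGroup.det X ^ N = 1 := by
    intro X hX
    induction hX using Subgroup.closure_induction with
    | mem x hx =>
      rcases hx with rfl | rfl
      · exact Units.ext hA
      · exact Units.ext hB
    | one => simp
    | mul x y _ _ hx hy => rw [map_mul, mul_pow, hx, hy, one_mul]
    | inv x _ hx => rw [map_inv, inv_pow, hx, inv_one]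
  obtain ⟨C, hC⟩ := h
  have hl : ∀ X ∈ l.image h₃ h₅, X.val.det ^ N = 1 := by
    rw [← hC]
    rintro _ ⟨X, hX, rfl⟩
    have h1 : GeneralLinearGroup.det (C * X * C⁻¹) = GeneralLinearGroup.det X := by
      rw [map_mul, map_mul, map_inv, mul_inv_cancel_comm]
    exact congrArg Units.val ((congrArg (· ^ N) h1).trans (hk X hX))
  have hgA := hl (l.genA h₃ h₅) (Subgroup.subset_closure (Set.mem_insert _ _))
  have hgB := hl l.genB (Subgroup.subset_closure (Set.mem_insert_of_mem _ rfl))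
  rw [genA_val] at hgA
  rw [genB_val] at hgB
  exact ⟨hgA, hgB⟩

/-- Order and `sqEqOneCount` separate the isomorphism types. The determinants form a group of order
1 or 2 for the two Q₈ entries and 1, 4, 2 for the three BD₃ entries, so the exponents N = 1 and N =
2 separate the rest. -/
theorem eq_of_conjugate {k l : Entry} (h : ConjugateInGL (k.image h₃ h₅) (l.image h₃ h₅)) :
    k = l := by
  have hdet : ∀ {k l : Entry}, ConjugateInGL (k.image h₃ h₅) (l.image h₃ h₅) → ∀ N : ℕ,
      (k.matA ζ₃ ζ₅).det ^ N = 1 → k.matB.det ^ N = 1 →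
        (l.matA ζ₃ ζ₅).det ^ N = 1 ∧ l.matB.det ^ N = 1 :=
    fun h N => det_pow_eq_one_of_conjugate h₃ h₅ h
  have hζ : ζ₃ ^ 2 * ζ₃ = 1 := by rw [← pow_succ, h₃.pow_eq_one]
  have hI : Complex.I ≠ 1 := isPrimitiveRoot_I.ne_one (by norm_num)
  have h1 : (-1 : ℂ) ≠ 1 := by norm_num
  have hsame := order_and_sqEqOneCount_eq_of_conjugate h₃ h₅ h
  have d1 := hdet h 1
  have d2 := hdet h 2
  have d1' := hdet h.symm 1
  have d2' := hdet h.symm 2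
  cases k <;> cases l <;> first
    | rfl
    | (exfalso; revert hsame; decide)
    | (exfalso; simp [matA, matB, Matrix.det_fin_three, hζ, hI, h1] at d1 d1' d2 d2')

end Entry

/-! ### Reducibility and irreducibility -/

namespace Entry

variable {ζ₃ ζ₅ : ℂ} (h₃ : IsPrimitiveRoot ζ₃ 3) (h₅ : IsPrimitiveRoot ζ₅ 5)

theorem linearRep_apply {n : ℕ} {G : Type*} [Group G] (ρ : G →* GL (Fin n) ℂ) (g : G)
    (v : Fin n → ℂ) : linearRep ρ g v = (ρ g).val *ᵥ v := rfl

theorem exists_smul_of_mem_image {k : Entry} (hk : k ≠ a4) {X : GL (Fin 3) ℂ}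
    (hX : X ∈ k.image h₃ h₅) : ∃ c : ℂ, c ≠ 0 ∧ X.val *ᵥ Pi.single 2 1 = c • Pi.single 2 1 := by
  induction hX using Subgroup.closure_induction with
  | mem x hx =>
    rcases hx with rfl | rfl
    · refine ⟨k.matA ζ₃ ζ₅ 2 2, ?_, ?_⟩
      · cases k <;> simp [matA] at hk ⊢
      · rw [genA_val]
        ext i
        cases k <;> fin_cases i <;> simp [matA] at hk ⊢
    · refine ⟨k.matB 2 2, ?_, ?_⟩
      · cases k <;> simp [matB] at hk ⊢
      · rw [genB_val]
        ext i
        cases k <;> fin_cases i <;> simp [matB] at hk ⊢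
  | one => exact ⟨1, one_ne_zero, by rw [Units.val_one, Matrix.one_mulVec, one_smul]⟩
  | mul x y _ _ hx hy =>
    obtain ⟨c, hc, hx⟩ := hx
    obtain ⟨d, hd, hy⟩ := hy
    refine ⟨d * c, mul_ne_zero hd hc, ?_⟩
    rw [Units.val_mul, ← Matrix.mulVec_mulVec, hy, Matrix.mulVec_smul, hx, smul_smul]
  | inv x _ hx =>
    obtain ⟨c, hc, hx⟩ := hx
    refine ⟨c⁻¹, inv_ne_zero hc, ?_⟩
    have h : (x⁻¹).val *ᵥ (x.val *ᵥ Pi.single 2 1) = (x⁻¹).val *ᵥ (c • Pi.single 2 1) := by rw [hx]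
    rw [Matrix.mulVec_mulVec, ← Units.val_mul, inv_mul_cancel, Units.val_one, Matrix.one_mulVec,
      Matrix.mulVec_smul] at h
    rw [eq_inv_smul_iff₀ hc, ← h]

/-- The third coordinate axis is invariant under both generators. -/
theorem not_isIrreducible_linearRep {k : Entry} (hk : k ≠ a4) :
    ¬ (linearRep (k.image h₃ h₅).subtype).IsIrreducible := by
  intro hirr
  let σ : Subrepresentation (linearRep (k.image h₃ h₅).subtype) :=
    { toSubmodule := Submodule.span ℂ {Pi.single 2 1}
      apply_mem_toSubmodule := by
        rintro g v hv
        obtain ⟨a, rfl⟩ := Submodule.mem_span_singleton.1 hv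
        obtain ⟨c, -, hc⟩ := exists_smul_of_mem_image h₃ h₅ hk g.2
        rw [map_smul]
        refine Submodule.smul_mem _ _ (Submodule.mem_span_singleton.2 ⟨c, ?_⟩)
        rw [linearRep_apply]
        exact hc.symm }
  rcases hirr.eq_bot_or_eq_top σ with h | h
  · have h1 : (Pi.single 2 1 : Fin 3 → ℂ) ∈ σ.toSubmodule := Submodule.mem_span_singleton_self _
    rw [h] at h1
    have h2 : (Pi.single 2 1 : Fin 3 → ℂ) = 0 := h1
    simpa using congrFun h2 2
  · have h1 : (Pi.single 0 1 : Fin 3 → ℂ) ∈ σ.toSubmodule := by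
      rw [h]
      exact Submodule.mem_top
    obtain ⟨c, hc⟩ := Submodule.mem_span_singleton.1 h1
    simpa using congrFun hc 0

/-- Cycling the coordinates makes the third one nonzero, adding the image under the diagonal
generator kills the other two, and cycling again yields all unit vectors. -/
theorem eq_top_of_mem_of_ne_zero {W : Submodule ℂ (Fin 3 → ℂ)}
    (hA : ∀ v ∈ W, a4.matA ζ₃ ζ₅ *ᵥ v ∈ W) (hB : ∀ v ∈ W, a4.matB *ᵥ v ∈ W) {w : Fin 3 → ℂ}
    (hw : w ∈ W) (hw0 : w ≠ 0) : W = ⊤ := by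
  have hAv : ∀ v : Fin 3 → ℂ, a4.matA ζ₃ ζ₅ *ᵥ v = ![v 2, v 0, v 1] := by
    intro v
    ext i
    fin_cases i <;> simp [matA, Matrix.mulVec, dotProduct, Fin.sum_univ_three]
  have hBv : ∀ v : Fin 3 → ℂ, a4.matB *ᵥ v = ![-v 0, -v 1, v 2] := by
    intro v
    ext i
    fin_cases i <;> simp [matB, Matrix.mulVec, dotProduct, Fin.sum_univ_three]
  have key : ∀ v ∈ W, v 2 ≠ 0 → (![0, 0, 1] : Fin 3 → ℂ) ∈ W := by
    intro v hv h2
    have h : (![0, 0, 1] : Fin 3 → ℂ) = (2 * v 2)⁻¹ • (v + a4.matB *ᵥ v) := by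
      have hsum : v + a4.matB *ᵥ v = ![0, 0, 2 * v 2] := by
        rw [hBv]
        ext i
        fin_cases i
        · exact add_neg_cancel (v 0)
        · exact add_neg_cancel (v 1)
        · exact (two_mul (v 2)).symm
      rw [hsum]
      ext i
      fin_cases i <;> simp
      field_simp
    rw [h]
    exact W.smul_mem _ (W.add_mem hv (hB v hv))
  have he2 : (![0, 0, 1] : Fin 3 → ℂ) ∈ W := by
    by_cases h2 : w 2 = 0
    · by_cases h1 : w 1 = 0
      · have h0 : w 0 ≠ 0 := by
          intro h0
          apply hw0
          ext i
          fin_cases i <;> simp [h0, h1, h2]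
        exact key _ (hA _ (hA w hw)) (by simpa [hAv] using h0)
      · exact key _ (hA w hw) (by simpa [hAv] using h1)
    · exact key w hw h2
  have he0 := hA _ he2
  have he1 := hA _ he0
  rw [eq_top_iff]
  intro v _
  have hv : v = v 0 • (a4.matA ζ₃ ζ₅ *ᵥ ![0, 0, 1]) +
      v 1 • (a4.matA ζ₃ ζ₅ *ᵥ (a4.matA ζ₃ ζ₅ *ᵥ ![0, 0, 1])) + v 2 • ![0, 0, 1] := by
    rw [hAv, hAv]
    ext i
    fin_cases i <;> simp
  rw [hv]
  exact W.add_mem (W.add_mem (W.smul_mem _ he0) (W.smul_mem _ he1)) (W.smul_mem _ he2)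

theorem isIrreducible_linearRep_a4 : (linearRep (a4.image h₃ h₅).subtype).IsIrreducible where
  exists_pair_ne := by
    refine ⟨⊥, ⊤, fun h => ?_⟩
    have h1 : (Pi.single 0 1 : Fin 3 → ℂ) ∈
        (⊥ : Subrepresentation (linearRep (a4.image h₃ h₅).subtype)).toSubmodule := by
      rw [h]
      exact Submodule.mem_top
    have h2 : (Pi.single 0 1 : Fin 3 → ℂ) = 0 := h1
    simpa using congrFun h2 0
  eq_bot_or_eq_top σ := by
    rw [or_iff_not_imp_left]
    intro hσ
    have hne : σ.toSubmodule ≠ ⊥ := fun h => hσ (Subrepresentation.toSubmodule_injective h)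
    obtain ⟨w, hw, hw0⟩ := Submodule.exists_mem_ne_zero_of_ne_bot hne
    apply Subrepresentation.toSubmodule_injective
    exact eq_top_of_mem_of_ne_zero (ζ₃ := ζ₃) (ζ₅ := ζ₅)
      (fun v hv => σ.apply_mem_toSubmodule
        ⟨a4.genA h₃ h₅, Subgroup.subset_closure (Set.mem_insert _ _)⟩ hv)
      (fun v hv => σ.apply_mem_toSubmodule
        ⟨a4.genB, Subgroup.subset_closure (Set.mem_insert_of_mem _ rfl)⟩ hv) hw hw0

/-! ### Every faithful small representation occurs in the table -/

/-- Matching parameters conjugate the generated subgroups; comparing cardinalities shows that A and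
B already generate H. -/
theorem conjugateInGL_image_of_hasForm {k : Entry} (hk : k ≠ a4) {H : Subgroup (GL (Fin 3) ℂ)}
    (hcard : Nat.card H = k.order) {A B : GL (Fin 3) ℂ} (hA : A ∈ H) (hB : B ∈ H)
    (h : HasForm A B (k.rotEigenvalue ζ₃ ζ₅) k.charA k.swapSign k.charB) :
    ConjugateInGL H (k.image h₃ h₅) := by
  obtain ⟨D, hDA, hDB⟩ := h.conj (hasForm_gen h₃ h₅ hk)
  have hconj : ConjugateInGL (Subgroup.closure {A, B}) (k.image h₃ h₅) :=
    conjugateInGL_closure_pair hDA hDB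
  have hle : Subgroup.closure {A, B} ≤ H := by
    rw [Subgroup.closure_le]
    rintro _ (rfl | rfl)
    · exact hA
    · exact hB
  have hfin : Finite H := Nat.finite_of_card_ne_zero (by rw [hcard]; exact k.order_pos.ne')
  obtain ⟨e⟩ := hconj.nonempty_equiv
  have heq : Subgroup.closure {A, B} = H := by
    refine Subgroup.eq_of_le_of_card_ge hle ?_
    rw [hcard, Nat.card_congr e.toEquiv, card_image]
  rwa [heq] at hconj

/-- Both B and A'B are swaps with e = 1, so smallness gives ν = -1 and μν = -1, hence μ = 1. -/
theorem exists_conjugate_of_dihedral {H : Subgroup (GL (Fin 3) ℂ)} (hH : IsSmall H)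
    {k : Entry} (hk : k ≠ a4) (hm : k.sqExponent = 0) (hcard : Nat.card H = k.order)
    {A B : GL (Fin 3) ℂ} (hA : A ∈ H) (hB : B ∈ H) (hn : orderOf A = k.rotOrder)
    (hAB : A * B * A = B) (hBB : B ^ 2 = 1) : ConjugateInGL H (k.image h₃ h₅) := by
  have : Finite H := Nat.finite_of_card_ne_zero (by rw [hcard]; exact k.order_pos.ne')
  have hfin : ∀ X ∈ H, IsOfFinOrder X := by
    intro X hX
    rw [← orderOf_pos_iff, ← Subgroup.orderOf_mk (H := H) X hX]
    exact orderOf_pos _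
  obtain ⟨A', hA', μ, ν, h, hμ, -, hν⟩ := exists_hasForm_of_isSmall (m := 0) k.three_le_rotOrder hn
    hAB (by rw [hBB, pow_zero]) (Or.inl rfl) hH hA (isPrimitiveRoot_rotEigenvalue h₃ h₅ k)
  rw [pow_zero] at h hν
  have hν1 := h.eq_neg_one_of_isSmall hH hB (hfin B hB) hν
  have hμν := (h.mul_right (rotEigenvalue_ne_zero h₃ h₅ k)).eq_neg_one_of_isSmall hH
    (mul_mem hA' hB) (hfin _ (mul_mem hA' hB)) (by rw [mul_pow, hμ, hν, one_mul])
  subst hν1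
  have hμ1 : μ = 1 := by linear_combination -hμν
  subst hμ1
  refine conjugateInGL_image_of_hasForm h₃ h₅ hk hcard hA' hB ?_
  have hs : k.swapSign = 1 := by
    rw [← rotEigenvalue_pow_sqExponent h₃ (ζ₅ := ζ₅), hm, pow_zero]
  rcases k.swapSign_cases with h' | ⟨-, h1, h2⟩
  · rw [hs] at h'
    norm_num at h'
  · rwa [hs, h1, h2]

theorem eq_one_or_eq_neg_one_of_sq {x : ℂ} (h : x ^ 2 = 1) : x = 1 ∨ x = -1 :=
  sq_eq_sq_iff_eq_or_eq_neg.1 (h.trans (one_pow 2).symm)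

/-- The signs (μ, ν) = (1, 1) give `q8₁`. The other three pairs are the nontrivial sign characters
of Q₈, and exchanging the generators or replacing B by A'B brings each of them to (-1, 1). -/
theorem exists_conjugate_of_quaternion {H : Subgroup (GL (Fin 3) ℂ)} (hH : IsSmall H)
    (hcard : Nat.card H = 8) {A B : GL (Fin 3) ℂ} (hA : A ∈ H) (hB : B ∈ H) (hn : orderOf A = 4)
    (hAB : A * B * A = B) (hBB : B ^ 2 = A ^ 2) : ∃ k : Entry, ConjugateInGL H (k.image h₃ h₅) := by
  obtain ⟨A', hA', μ, ν, h, hμ, -, hν⟩ := exists_hasForm_of_isSmall (m := 2) (by norm_num) hn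
    hAB hBB (Or.inr rfl) hH hA isPrimitiveRoot_I
  rw [hμ] at hν
  rw [Complex.I_sq] at h
  rcases eq_one_or_eq_neg_one_of_sq hμ with rfl | rfl <;>
    rcases eq_one_or_eq_neg_one_of_sq hν with rfl | rfl
  · exact ⟨q8₁, conjugateInGL_image_of_hasForm h₃ h₅ (by simp) hcard hA' hB h⟩
  · exact ⟨q8₂, conjugateInGL_image_of_hasForm h₃ h₅ (by simp) hcard hB hA' h.swap⟩
  · exact ⟨q8₂, conjugateInGL_image_of_hasForm h₃ h₅ (by simp) hcard hA' hB h⟩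
  · have h' := h.mul_right Complex.I_ne_zero
    rw [neg_one_mul, neg_neg] at h'
    exact ⟨q8₂, conjugateInGL_image_of_hasForm h₃ h₅ (by simp) hcard hA' (mul_mem hA' hB) h'⟩

/-- Here ν² = μ³ = μ, so μ = -1 forces ν = ±i; replacing B by A'B changes the sign of ν and
identifies these two cases. -/
theorem exists_conjugate_of_dicyclic {H : Subgroup (GL (Fin 3) ℂ)} (hH : IsSmall H)
    (hcard : Nat.card H = 12) {A B : GL (Fin 3) ℂ} (hA : A ∈ H) (hB : B ∈ H) (hn : orderOf A = 6)
    (hAB : A * B * A = B) (hBB : B ^ 2 = A ^ 3) : ∃ k : Entry, ConjugateInGL H (k.image h₃ h₅) := by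
  have hroot := isPrimitiveRoot_neg_sq h₃
  obtain ⟨A', hA', μ, ν, h, hμ, -, hν⟩ := exists_hasForm_of_isSmall (m := 3) (by norm_num) hn
    hAB hBB (Or.inr rfl) hH hA hroot
  have h3 : (-(ζ₃ ^ 2)) ^ 3 = -1 := rotEigenvalue_pow_sqExponent (ζ₅ := ζ₅) h₃ bd3₁
  rw [pow_succ μ, hμ, one_mul] at hν
  rw [h3] at h
  rcases eq_one_or_eq_neg_one_of_sq hμ with rfl | rfl
  · rcases eq_one_or_eq_neg_one_of_sq hν with rfl | rfl
    · exact ⟨bd3₁, conjugateInGL_image_of_hasForm h₃ h₅ (by simp) hcard hA' hB h⟩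
    · exact ⟨bd3₃, conjugateInGL_image_of_hasForm h₃ h₅ (by simp) hcard hA' hB h⟩
  · rw [← Complex.I_sq, sq_eq_sq_iff_eq_or_eq_neg] at hν
    rcases hν with rfl | rfl
    · exact ⟨bd3₂, conjugateInGL_image_of_hasForm h₃ h₅ (by simp) hcard hA' hB h⟩
    · have h' := h.mul_right (hroot.ne_zero (by norm_num))
      rw [neg_one_mul, neg_neg] at h'
      exact ⟨bd3₂, conjugateInGL_image_of_hasForm h₃ h₅ (by simp) hcard hA' (mul_mem hA' hB) h'⟩

theorem exists_conjugate_range {G : Type*} [Group G] [Finite G] (hcard : Nat.card G ≤ 12)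
    (hG : ∃ a b : G, a * b ≠ b * a) {ρ : G →* GL (Fin 3) ℂ} (hρ : Function.Injective ρ)
    (hsmall : IsSmall ρ.range) : ∃ k : Entry, ConjugateInGL ρ.range (k.image h₃ h₅) := by
  rcases classification_of_card_le_twelve hcard hG with
    ⟨n, m, a, b, hn3, hn6, hc, ha, hab, hb, hm⟩ | ⟨⟨e⟩⟩
  · have hH : Nat.card ρ.range = 2 * n := by
      rw [← hc, Nat.card_congr (MonoidHom.ofInjective hρ).toEquiv]
    have hA : ρ a ∈ ρ.range := ⟨a, rfl⟩
    have hB : ρ b ∈ ρ.range := ⟨b, rfl⟩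
    have ho : orderOf (ρ a) = n := by rw [orderOf_injective ρ hρ, ha]
    have hAB : ρ a * ρ b * ρ a = ρ b := by rw [← map_mul, ← map_mul, hab]
    have hBB : ρ b ^ 2 = ρ a ^ m := by rw [← map_pow, ← map_pow, hb]
    rcases hm with rfl | rfl
    · rw [pow_zero] at hBB
      interval_cases n
      · exact ⟨s3, exists_conjugate_of_dihedral h₃ h₅ hsmall (by simp) rfl hH hA hB ho hAB hBB⟩
      · exact ⟨d8, exists_conjugate_of_dihedral h₃ h₅ hsmall (by simp) rfl hH hA hB ho hAB hBB⟩
      · exact ⟨d10, exists_conjugate_of_dihedral h₃ h₅ hsmall (by simp) rfl hH hA hB ho hAB hBB⟩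
      · exact ⟨d12, exists_conjugate_of_dihedral h₃ h₅ hsmall (by simp) rfl hH hA hB ho hAB hBB⟩
    · obtain rfl | rfl : m = 2 ∨ m = 3 := by omega
      · exact exists_conjugate_of_quaternion h₃ h₅ hsmall hH hA hB ho hAB hBB
      · exact exists_conjugate_of_dicyclic h₃ h₅ hsmall hH hA hB ho hAB hBB
  · have hf : Function.Injective (ρ.comp e.symm.toMonoidHom) := hρ.comp e.symm.injective
    have hrange : (ρ.comp e.symm.toMonoidHom).range = ρ.range := by
      rw [MonoidHom.range_comp, MonoidHom.range_eq_top.2 e.symm.surjective, MonoidHom.range_eq_map]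
    exact ⟨a4, hrange ▸ conjugateInGL_range_of_alternatingGroup h₃ h₅ hf⟩

end Entry

theorem mainTheorem4 (ζ₃ ζ₅ : ℂ) (h₃ : IsPrimitiveRoot ζ₃ 3) (h₅ : IsPrimitiveRoot ζ₅ 5) :
    -- every entry is a small matrix group, isomorphic to the stated non-abelian group,
    -- which has at most 12 elements
    (∀ k : Entry,
      Finite k.Model ∧ Nat.card k.Model ≤ 12 ∧ (∃ a b : k.Model, a * b ≠ b * a) ∧
        Nonempty (k.Model ≃* k.image h₃ h₅) ∧ IsSmall (k.image h₃ h₅)) ∧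
    -- every faithful small representation of a non-abelian group of order at most 12
    -- is, up to conjugacy, one of the entries
    (∀ (G : Type*) [Group G] [Finite G], Nat.card G ≤ 12 → (∃ a b : G, a * b ≠ b * a) →
      ∀ ρ : G →* GL (Fin 3) ℂ, Function.Injective ρ → IsSmall ρ.range →
        ∃ k : Entry, Nonempty (G ≃* k.Model) ∧ ConjugateInGL ρ.range (k.image h₃ h₅)) ∧
    -- no entry is listed twice
    (∀ k l : Entry, ConjugateInGL (k.image h₃ h₅) (l.image h₃ h₅) → k = l) ∧
    -- exactly the entry of the alternating group is irreducible
    (∀ k : Entry,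
      (linearRep (k.image h₃ h₅).subtype).IsIrreducible ↔ k = Entry.a4) := by
  refine ⟨fun k => ⟨k.finite_model, k.card_model.trans_le k.order_le,
    k.exists_not_commute_model h₃ h₅, k.nonempty_model_equiv_image h₃ h₅, k.isSmall_image h₃ h₅⟩,
    ?_, fun k l h => Entry.eq_of_conjugate h₃ h₅ h, fun k => ⟨fun h => ?_, ?_⟩⟩
  · intro G _ _ hcard hG ρ hρ hsmall
    obtain ⟨k, hk⟩ := Entry.exists_conjugate_range h₃ h₅ hcard hG hρ hsmall
    obtain ⟨e⟩ := hk.nonempty_equiv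
    obtain ⟨e'⟩ := k.nonempty_model_equiv_image h₃ h₅
    exact ⟨k, ⟨((MonoidHom.ofInjective hρ).trans e).trans e'.symm⟩, hk⟩
  · by_contra hk
    exact Entry.not_isIrreducible_linearRep h₃ h₅ hk h
  · rintro rfl
    exact Entry.isIrreducible_linearRep_a4 h₃ h₅
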